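/- \textbf{Setting.} Fix a Grothendieck universe of \emph{small} sets, a category $\mathcal C$ with a set of objects and sets of morphisms, and let $\mathcal E=\mathrm{Psh}(\mathcal C)$ be the category of presheaves on $\mathcal C$ (with values in sets, not necessarily small). Let $\mathsf U\in\mathcal E$ be the Hofmann--Streicher universe, $\mathsf U(c)=\mathrm{Obj}[(\mathcal C/c)^{op},\mathbf{Set}_{small}]$, let $\mathsf E(c)=\mathrm{Obj}[(\mathcal C/c)^{op},\mathbf{Set}^\bullet_{small}]$ (pointed small sets), and let $\pi:\mathsf E\to \mathsf U$ be the forgetful map. In the internal type theory, a context is an object $\Gamma\in\mathcal E$; a type over $\Gamma$ is a map $\alpha:\Gamma\to\mathsf U$; a term $\Gamma\vdash a:\alpha$ is a map $a:\Gamma\to\mathsf E$ with $\pi a=\alpha$; the extended context $\Gamma.\alpha$, with display map $p_\alpha:\Gamma.\alpha\to\Gamma$, is the pullback of $\pi$ along $\alpha$; substitution is precomposition. \textbf{Cofibrations.} A class of cofibrations is a class of monomorphisms in $\mathcal E$ that contains $0\to1$ and $\mathrm{id}_1$, is stable under pullback and closed under composition, has a terminal object in the category of its members and cartesian squares, and is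 closed under joins of subobjects (if $S,T\rightarrowtail X$ are cofibrations, so is $S\vee T\rightarrowtail X$). Fix such a class. Write $\Phi(c)$ for the set of subobjects of $\mathsf y c$ whose inclusion is a cofibration. \textbf{Interval.} Let $\mathbb I\in\mathcal E$ be a tiny interval with connections: there are maps $\delta^0\neq\delta^1:1\to\mathbb I$, both cofibrations, and maps $\sqcap_k:\mathbb I\times\mathbb I\to\mathbb I$ ($k=0,1$) with $\sqcap_k(\delta^k,i)=\delta^k=\sqcap_k(i,\delta^k)$ and $\sqcap_k(\delta^{1-k},i)=i=\sqcap_k(i,\delta^{1-k})$, and the functor $X\mapsto X^{\mathbb I}$ has a right adjoint $X\mapsto X_{\mathbb I}$. Write $\mathsf{con}_X:X\to X^{\mathbb I}$ for the constant path map. \textbf{Fibrations.} For $\alpha:X\to\mathsf U$ let $\mathrm{Fill}(\alpha)\to X^{\mathbb I}$ be the object whose elements at stage $c$ over $x:\mathbb I\times\mathsf yc\to X$ are pairs $(s_0,s_1)$, where $s_k$ assigns to each $f:d\to c$, each $\varphi\in\Phi(d)$, each $v:\mathbb I\times\varphi\to\mathsf E$ and each $a:\mathsf yd\to\mathsf E$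 lying over the corresponding restrictions of $\alpha\circ x\circ(\mathbb I\times f)$ and satisfying $v(\delta^k,-)=a|_\varphi$, a map $\mathbb I\times\mathsf yd\to\mathsf E$ over $\alpha\circ x\circ(\mathbb I\times f)$ which restricts to $v$ on $\mathbb I\times\varphi$ and to $a$ at $\delta^k$, uniformly in $d$. Let $\mathsf{Fib}^*(\alpha)\to X$ be the pullback of $\mathrm{Fill}(\alpha)_{\mathbb I}\to (X^{\mathbb I})_{\mathbb I}$ along the unit $X\to(X^{\mathbb I})_{\mathbb I}$, and let $\mathsf{Fib}=\mathsf{Fib}^*(\mathrm{id}_{\mathsf U})\to\mathsf U$, the base of the universal small uniform fibration. A judgement $\Gamma\vdash A\ \mathrm{type}$ means a map $A:\Gamma\to\mathsf{Fib}$; it is written $A=(\alpha,f)$, where $\alpha:\Gamma\to\mathsf U$ is its underlying type, and terms of $A$ are terms of $\alpha$. \textbf{Path types.} For $\alpha:\Gamma\to\mathsf U$ a path type is a type $\alpha^{\mathbb I}$ over $\Gamma.\alpha.\alpha$ (variables $x,y:\alpha$) such that $\Gamma.\alpha.\alpha.\alpha^{\mathbb I}$ is the pullback of $p_\alpha^{\mathbb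 I}:(\Gamma.\alpha)^{\mathbb I}\to\Gamma^{\mathbb I}$ along $\mathsf{con}_\Gamma:\Gamma\to\Gamma^{\mathbb I}$, with $x$ and $y$ the values of the path at $\delta^0$ and $\delta^1$. \textbf{Theorem.} Path types exist for all types in all contexts, and can be chosen strictly stably under substitution. For every such strictly stable choice, the following hold. \begin{enumerate} \item (Formation) For every context $\Gamma$ and every $A=(\alpha,f):\Gamma\to\mathsf{Fib}$ there is $A^{\mathbb I}=(\alpha^{\mathbb I},f'):\Gamma.\alpha.\alpha\to\mathsf{Fib}$, that is, $x:A,\,y:A\vdash A^{\mathbb I}(x,y)\ \mathrm{type}$, strictly stably under substitution in $\Gamma$. \item (Introduction) The constant paths give a term $x:A\vdash\mathsf{con}(x):A^{\mathbb I}(x,x)$. \item (Elimination) Given $x:A,\,y:A,\,z:A^{\mathbb I}(x,y)\vdash B(x,y,z)\ \mathrm{type}$ and $x:A\vdash b(x):B(x,x,\mathsf{con}(x))$ there is a term $x:A,\,y:A,\,z:A^{\mathbb I}(x,y)\vdash \mathsf j_b(x,y,z):B(x,y,z)$; the operation $(\Gamma,A,B,b)\mapsto\mathsf j_b$ can be chosen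 strictly stable under substitution in $\Gamma$. \item (Computation) If moreover the constant path map $\mathsf{con}:\Gamma.\alpha\to\Gamma.\alpha.\alpha.\alpha^{\mathbb I}$ is a cofibration, then $\mathsf j_b$ can be chosen such that $x:A\vdash\mathsf j_b(x,x,\mathsf{con}(x))=b(x):B(x,x,\mathsf{con}(x))$; on the class of all $(\Gamma,A)$ with $\mathsf{con}$ a cofibration, an elimination operation with this property can again be chosen strictly stable under substitution. \end{enumerate} -/

import Mathlib

open CategoryTheory Limits Opposite MonoidalCategory CartesianMonoidalCategory

universe w v u

noncomputable section

namespace PshTT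

/-! ## Presheaves, small sets, the Hofmann–Streicher universe

Small sets are the types in `Type w`; the ambient sets live in a universe large enough to contain
`Type w` as an element and the (arbitrary) base category `C`. -/

/-- The presheaf topos over `C`. -/
abbrev Psh (C : Type u) [Category.{v} C] : Type _ := Cᵒᵖ ⥤ Type (max (w + 1) v u)

variable {C : Type u} [Category.{v} C]

/-- The Yoneda embedding. -/
abbrev yo : C ⥤ Psh.{w} C := uliftYoneda.{max (w + 1) u}

variable (C) in
/-- The universe: `U(c)` is the set of presheaves of small sets on the slice `C/c`; restriction is
precomposition with the composition functor between slices. -/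
def U : Psh.{w} C where
  obj c := (Over c.unop)ᵒᵖ ⥤ Type w
  map f := ↾ fun F => (Over.map f.unop).op ⋙ F
  map_id _ := by
    ext F
    change (Over.map (𝟙 _)).op ⋙ F = F
    rw [Over.mapId_eq]; rfl
  map_comp f g := by
    ext F
    change (Over.map (g.unop ≫ f.unop)).op ⋙ F = _
    rw [Over.mapComp_eq]; rfl

variable (C) in
/-- The pointed universe: presheaves of pointed small sets on the slice `C/c`. -/
def E : Psh.{w} C where
  obj c := (Over c.unop)ᵒᵖ ⥤ Pointed.{w}
  map f := ↾ fun F => (Over.map f.unop).op ⋙ F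
  map_id _ := by
    ext F
    change (Over.map (𝟙 _)).op ⋙ F = F
    rw [Over.mapId_eq]; rfl
  map_comp f g := by
    ext F
    change (Over.map (g.unop ≫ f.unop)).op ⋙ F = _
    rw [Over.mapComp_eq]; rfl

variable (C) in
/-- The small map classifier `π : E ⟶ U`. -/
def disp : E.{w} C ⟶ U.{w} C where
  app _ := ↾ fun F => F ⋙ forget Pointed.{w}
  naturality _ _ _ := rfl

/-! ## Contexts, types, terms

A context is a presheaf `Γ`, a type in context `Γ` is a map `α : Γ ⟶ U`, and a term
`Γ ⊢ a : α` is a map `a : Γ ⟶ E` with `a ≫ disp = α`. -/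

section Contexts

variable {Γ Δ : Psh.{w} C}

/-- Context extension `Γ.α`, the pullback of `disp` along `α`. -/
abbrev ext (α : Γ ⟶ U.{w} C) : Psh.{w} C := pullback α (disp.{w} C)

/-- The display map `Γ.α ⟶ Γ`. -/
abbrev proj (α : Γ ⟶ U.{w} C) : ext α ⟶ Γ := pullback.fst α (disp.{w} C)

/-- The generic term of `α` in context `Γ.α`. -/
abbrev var (α : Γ ⟶ U.{w} C) : ext α ⟶ E.{w} C := pullback.snd α (disp.{w} C)

/-- The map `(f, a) : Δ ⟶ Γ.α` determined by `f : Δ ⟶ Γ` and a term `Δ ⊢ a : α(f)`. -/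
abbrev pair {α : Γ ⟶ U.{w} C} (f : Δ ⟶ Γ) (a : Δ ⟶ E.{w} C) (h : a ≫ disp.{w} C = f ≫ α) : Δ ⟶ ext α :=
  pullback.lift f a h.symm

/-- The substitution `Δ.α(σ) ⟶ Γ.α` over `σ : Δ ⟶ Γ`. -/
abbrev extMap {α : Γ ⟶ U.{w} C} {β : Δ ⟶ U.{w} C} (σ : Δ ⟶ Γ) (h : σ ≫ α = β) : ext β ⟶ ext α :=
  pair (proj β ≫ σ) (var β) (by rw [← pullback.condition, Category.assoc, h])

/-- The context `Γ, x : α, y : α`. -/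
abbrev ext₂ (α : Γ ⟶ U.{w} C) : Psh.{w} C := ext (proj α ≫ α)

lemma extMap_proj {α : Γ ⟶ U.{w} C} {β : Δ ⟶ U.{w} C} (σ : Δ ⟶ Γ) (h : σ ≫ α = β) :
    extMap σ h ≫ proj α = proj β ≫ σ := pullback.lift_fst _ _ _

lemma ext₂Map_aux {α : Γ ⟶ U.{w} C} {β : Δ ⟶ U.{w} C} (σ : Δ ⟶ Γ) (h : σ ≫ α = β) :
    extMap σ h ≫ proj α ≫ α = proj β ≫ β := by
  rw [← Category.assoc, extMap_proj, Category.assoc, h]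

/-- The substitution between the contexts `x, y : α(σ)` and `x, y : α` over `σ`. -/
abbrev ext₂Map {α : Γ ⟶ U.{w} C} {β : Δ ⟶ U.{w} C} (σ : Δ ⟶ Γ) (h : σ ≫ α = β) : ext₂ β ⟶ ext₂ α :=
  extMap (extMap σ h) (ext₂Map_aux σ h)

/-- The first variable `x`, as a map `Γ.α.α ⟶ Γ.α`. -/
abbrev fstVar (α : Γ ⟶ U.{w} C) : ext₂ α ⟶ ext α := proj (proj α ≫ α)

/-- The second variable `y`, as a map `Γ.α.α ⟶ Γ.α`. -/
abbrev sndVar (α : Γ ⟶ U.{w} C) : ext₂ α ⟶ ext α := extMap (proj α) rfl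

/-- The diagonal `Γ.α ⟶ Γ.α.α`, sending `x` to `(x, x)`. -/
abbrev diag (α : Γ ⟶ U.{w} C) : ext α ⟶ ext₂ α :=
  pair (𝟙 _) (var α) (by rw [Category.id_comp, pullback.condition])

end Contexts

/-! ## Cofibrations and the interval -/

variable (C) in
/-- A class of cofibrations in the presheaf topos. -/
structure CofibrationClass where
  /-- The class of maps. -/
  cof : MorphismProperty (Psh.{w} C)
  mono : ∀ {S T : Psh.{w} C} (m : S ⟶ T), cof m → Mono m
  initial : ∀ m : (⊥_ (Psh.{w} C)) ⟶ (⊤_ (Psh.{w} C)), cof m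
  identity : cof (𝟙 (⊤_ (Psh.{w} C)))
  pullback : ∀ {S T S' T' : Psh.{w} C} {s : S' ⟶ S} {m' : S' ⟶ T'} {m : S ⟶ T} {t : T' ⟶ T},
    IsPullback s m' m t → cof m → cof m'
  comp : ∀ {R S T : Psh.{w} C} (m : R ⟶ S) (n : S ⟶ T), cof m → cof n → cof (m ≫ n)
  /-- The category of cofibrations and cartesian squares has a terminal object. -/
  terminal : ∃ (D Φ : Psh.{w} C) (τ : D ⟶ Φ), cof τ ∧
    ∀ {S T : Psh.{w} C} (m : S ⟶ T), cof m →
      ∃! p : (S ⟶ D) × (T ⟶ Φ), IsPullback p.1 m τ p.2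
  /-- Joins of cofibrant subobjects are cofibrant. -/
  join : ∀ {X : Psh.{w} C} (S T : Subfunctor X), cof S.ι → cof T.ι → cof (S ⊔ T).ι

/-- An interval with connections. The endpoints and connections are indexed by `k : Bool`,
with `false` for `0` and `true` for `1`. -/
structure Interval (Cof : CofibrationClass.{w} C) where
  /-- The underlying presheaf. -/
  I : Psh.{w} C
  /-- The endpoints. -/
  δ : Bool → (𝟙_ (Psh.{w} C) ⟶ I)
  /-- The connections. -/
  conn : Bool → (I ⊗ I ⟶ I)
  δ_ne : δ false ≠ δ true
  δ_cof : ∀ k, Cof.cof (δ k)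
  conn_left : ∀ k, lift (toUnit I ≫ δ k) (𝟙 I) ≫ conn k = toUnit I ≫ δ k
  conn_right : ∀ k, lift (𝟙 I) (toUnit I ≫ δ k) ≫ conn k = toUnit I ≫ δ k
  conn_left' : ∀ k, lift (toUnit I ≫ δ (!k)) (𝟙 I) ≫ conn k = 𝟙 I
  conn_right' : ∀ k, lift (𝟙 I) (toUnit I ≫ δ (!k)) ≫ conn k = 𝟙 I

variable {Cof : CofibrationClass.{w} C} (J : Interval Cof)

/-- The path functor `X ↦ X^I`. -/
abbrev path : Psh.{w} C ⥤ Psh.{w} C := ihom J.I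

/-- The inclusion of `Y` into the cylinder `I × Y` at the endpoint `k`. -/
abbrev endpt (k : Bool) (Y : Psh.{w} C) : Y ⟶ J.I ⊗ Y := lift (toUnit Y ≫ J.δ k) (𝟙 Y)

/-- Evaluation of paths at the endpoint `k`. -/
abbrev evAt (k : Bool) (X : Psh.{w} C) : (path J).obj X ⟶ X :=
  endpt J k ((path J).obj X) ≫ (ihom.ev J.I).app X

/-- The constant path map. -/
abbrev const (X : Psh.{w} C) : X ⟶ (path J).obj X := MonoidalClosed.curry (snd J.I X)

/-- The interval is tiny: the path functor has a right adjoint. -/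
abbrev Interval.IsTiny : Prop := (path J).IsLeftAdjoint

/-! ## Filling structures and the object of fibration structures -/

/-- A filling problem, from the endpoint `k`, for a type `β` over the cylinder `I × y d`: a
generating cofibration `φ ↪ y d`, a partial element `v` over `I × φ`, and an element `a` over
the end `k` of the cylinder, which agree on `φ`. -/
structure Problem (k : Bool) {d : C} (β : J.I ⊗ yo.{w}.obj d ⟶ U.{w} C) where
  φ : Subfunctor (yo.{w}.obj d)
  cof : Cof.cof φ.ι
  v : J.I ⊗ φ.toFunctor ⟶ E.{w} C
  a : yo.{w}.obj d ⟶ E.{w} C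
  v_type : v ≫ disp.{w} C = J.I ◁ φ.ι ≫ β
  a_type : a ≫ disp.{w} C = endpt J k _ ≫ β
  compat : endpt J k _ ≫ v = φ.ι ≫ a

variable {J}

lemma endpt_naturality (k : Bool) {X Y : Psh.{w} C} (f : X ⟶ Y) :
    endpt J k X ≫ J.I ◁ f = f ≫ endpt J k Y := by
  ext1 <;> simp

lemma isPullback_preimage {X Y : Psh.{w} C} (φ : Subfunctor Y) (f : X ⟶ Y) :
    IsPullback (φ.fromPreimage f) (φ.preimage f).ι φ.ι f := by
  refine ⟨⟨φ.fromPreimage_ι f⟩, ⟨?_⟩⟩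
  have key : ∀ s : PullbackCone φ.ι f, Subfunctor.range s.snd ≤ φ.preimage f := by
    rintro s c _ ⟨x, rfl⟩
    change f.app c (s.snd.app c x) ∈ φ.obj c
    have := congr_arg (fun t => t.app c x) s.condition
    change (s.fst.app c x).1 = f.app c (s.snd.app c x) at this
    rw [← this]
    exact (s.fst.app c x).2
  refine PullbackCone.IsLimit.mk _ (fun s => Subfunctor.lift s.snd (key s))
    (fun s => ?_) (fun s => Subfunctor.lift_ι _ _) (fun s m _ h => ?_)
  · rw [← cancel_mono φ.ι, s.condition]
    rfl
  · rw [← cancel_mono (φ.preimage f).ι, h]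
    rfl

lemma cof_preimage {X Y : Psh.{w} C} (φ : Subfunctor Y) (f : X ⟶ Y) (h : Cof.cof φ.ι) :
    Cof.cof (φ.preimage f).ι :=
  Cof.pullback (isPullback_preimage φ f) h

/-- Restriction of a filling problem along `g : e ⟶ d`. -/
def Problem.restrict {k : Bool} {d e : C} {β : J.I ⊗ yo.{w}.obj d ⟶ U.{w} C}
    {β' : J.I ⊗ yo.{w}.obj e ⟶ U.{w} C} (P : Problem J k β) (g : e ⟶ d)
    (h : J.I ◁ yo.{w}.map g ≫ β = β') : Problem J k β' where
  φ := P.φ.preimage (yo.{w}.map g)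
  cof := cof_preimage _ _ P.cof
  v := J.I ◁ P.φ.fromPreimage (yo.{w}.map g) ≫ P.v
  a := yo.{w}.map g ≫ P.a
  v_type := by
    rw [Category.assoc, P.v_type, ← h, ← whiskerLeft_comp_assoc, ← whiskerLeft_comp_assoc,
      Subfunctor.fromPreimage_ι]
  a_type := by
    rw [Category.assoc, P.a_type, ← h, ← Category.assoc, ← Category.assoc, endpt_naturality]
  compat := by
    rw [← Category.assoc, endpt_naturality, Category.assoc, P.compat, ← Category.assoc,
      ← Category.assoc, Subfunctor.fromPreimage_ι]

/-- Transport of a filling problem along an equality of types. -/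
def Problem.cast {k : Bool} {d : C} {β β' : J.I ⊗ yo.{w}.obj d ⟶ U.{w} C} (P : Problem J k β)
    (h : β = β') : Problem J k β' where
  φ := P.φ
  cof := P.cof
  v := P.v
  a := P.a
  v_type := by rw [← h]; exact P.v_type
  a_type := by rw [← h]; exact P.a_type
  compat := P.compat

/-- An element at stage `c` of the type of filling structures (from the endpoint `k`) on the
`I`-indexed family `β`: fillers, uniformly in all `f : d ⟶ c`. -/
@[ext]
structure FillStr (k : Bool) {c : C} (β : J.I ⊗ yo.{w}.obj c ⟶ U.{w} C) where
  fill : ∀ {d : C} (f : d ⟶ c), Problem J k (J.I ◁ yo.{w}.map f ≫ β) → (J.I ⊗ yo.{w}.obj d ⟶ E.{w} C)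
  fill_type : ∀ {d : C} (f : d ⟶ c) (P : Problem J k (J.I ◁ yo.{w}.map f ≫ β)),
    fill f P ≫ disp.{w} C = J.I ◁ yo.{w}.map f ≫ β
  fill_endpt : ∀ {d : C} (f : d ⟶ c) (P : Problem J k (J.I ◁ yo.{w}.map f ≫ β)),
    endpt J k _ ≫ fill f P = P.a
  fill_partial : ∀ {d : C} (f : d ⟶ c) (P : Problem J k (J.I ◁ yo.{w}.map f ≫ β)),
    J.I ◁ P.φ.ι ≫ fill f P = P.v
  uniform : ∀ {d e : C} (f : d ⟶ c) (g : e ⟶ d) (l : e ⟶ c) (h : g ≫ f = l)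
    (P : Problem J k (J.I ◁ yo.{w}.map f ≫ β)),
    fill l (P.restrict g (by rw [← h, Functor.map_comp, whiskerLeft_comp_assoc])) =
      J.I ◁ yo.{w}.map g ≫ fill f P

lemma restrict_aux {c c' d : C} {β : J.I ⊗ yo.{w}.obj c ⟶ U.{w} C}
    {β' : J.I ⊗ yo.{w}.obj c' ⟶ U.{w} C} (f : d ⟶ c') (g : c' ⟶ c)
    (h : J.I ◁ yo.{w}.map g ≫ β = β') :
    J.I ◁ yo.{w}.map f ≫ β' = J.I ◁ yo.{w}.map (f ≫ g) ≫ β := by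
  rw [← h, Functor.map_comp, whiskerLeft_comp_assoc]

/-- Restriction of filling structures along `g : c' ⟶ c`. -/
def FillStr.restrict {k : Bool} {c c' : C} {β : J.I ⊗ yo.{w}.obj c ⟶ U.{w} C}
    {β' : J.I ⊗ yo.{w}.obj c' ⟶ U.{w} C} (s : FillStr k β) (g : c' ⟶ c)
    (h : J.I ◁ yo.{w}.map g ≫ β = β') : FillStr k β' where
  fill f P := s.fill (f ≫ g) (P.cast (restrict_aux f g h))
  fill_type f P := (s.fill_type (f ≫ g) (P.cast (restrict_aux f g h))).trans
    (restrict_aux f g h).symm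
  fill_endpt f P := s.fill_endpt (f ≫ g) (P.cast (restrict_aux f g h))
  fill_partial f P := s.fill_partial (f ≫ g) (P.cast (restrict_aux f g h))
  uniform f g' l e P := s.uniform (f ≫ g) g' (l ≫ g) (by rw [← e, Category.assoc])
    (P.cast (restrict_aux f g h))

lemma FillStr.fill_congr {k : Bool} {c d : C} {β : J.I ⊗ yo.{w}.obj c ⟶ U.{w} C} (s : FillStr k β)
    {f f' : d ⟶ c} (h : f = f') (P : Problem J k (J.I ◁ yo.{w}.map f ≫ β)) :
    s.fill f P = s.fill f' (P.cast (by rw [h])) := by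
  subst h; rfl

section Fill

variable {X : Psh.{w} C} (α : X ⟶ U.{w} C)

/-- An element at stage `c` of `Fill(α ∘ x)`, `x : X^I`: a path `x` in `X`, together with filling
structures from both endpoints on the family `α ∘ x`. -/
structure FillElem (J : Interval Cof) (c : C) where
  x : J.I ⊗ yo.{w}.obj c ⟶ X
  str : ∀ k : Bool, FillStr k (x ≫ α)

variable {α} in
lemma FillElem.ext' {c : C} {s t : FillElem α J c} (h : s.x = t.x)
    (h' : ∀ (k : Bool) (d : C) (f : d ⟶ c) (P : Problem J k (J.I ◁ yo.{w}.map f ≫ s.x ≫ α)),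
      (s.str k).fill f P = (t.str k).fill f (P.cast (by rw [h]))) : s = t := by
  obtain ⟨x, s⟩ := s
  obtain ⟨y, t⟩ := t
  obtain rfl : x = y := h
  congr 1
  funext k
  ext d f P : 4
  exact h' k d f P

/-- The restriction of `FillElem`s. -/
def FillElem.restrict {c c' : C} (s : FillElem α J c) (g : c' ⟶ c) : FillElem α J c' where
  x := J.I ◁ yo.{w}.map g ≫ s.x
  str k := (s.str k).restrict g (by rw [Category.assoc])

variable (J) in
/-- The object `Fill(α ∘ x)` over `x : X^I`. -/
def Fill : Psh.{w} C where
  obj c := FillElem α J c.unop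
  map g := ↾ fun s => s.restrict α g.unop
  map_id c := by
    ext s
    refine FillElem.ext' (s := s.restrict α (𝟙 c.unop)) (t := s) ?_ ?_
    · simp [FillElem.restrict]
    · intro k d f P
      exact (s.str k).fill_congr (Category.comp_id f) (P.cast _)
  map_comp {c₁ c₂ c₃} g h := by
    ext s
    refine FillElem.ext' (s := s.restrict α (h.unop ≫ g.unop))
      (t := (s.restrict α g.unop).restrict α h.unop) ?_ ?_
    · simp only [FillElem.restrict, Functor.map_comp, whiskerLeft_comp, Category.assoc]
    · intro k d f P
      exact (s.str k).fill_congr (Category.assoc f h.unop g.unop).symm (P.cast _)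

variable (J) in
/-- The projection of `Fill(α ∘ x)` to `X^I`. -/
def fillProj : Fill J α ⟶ (path J).obj X where
  app c := ↾ fun s => uliftYonedaEquiv (MonoidalClosed.curry s.x)
  naturality _ _ g := by
    ext s
    change uliftYonedaEquiv (MonoidalClosed.curry (J.I ◁ yo.{w}.map g.unop ≫ s.x)) =
      ((path J).obj X).map g (uliftYonedaEquiv (MonoidalClosed.curry s.x))
    rw [uliftYonedaEquiv_naturality, MonoidalClosed.curry_natural_left]

variable (J) [J.IsTiny]

/-- The root functor, right adjoint to the path functor. -/
abbrev root : Psh.{w} C ⥤ Psh.{w} C := (path J).rightAdjoint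

/-- The object `Fib*(α)` of fibration structures on `α`: the pullback of the root of
`Fill(α ∘ x) ⟶ X^I` along the unit `X ⟶ (X^I)_I`. -/
abbrev FibStar : Psh.{w} C :=
  pullback ((Adjunction.ofIsLeftAdjoint (path J)).unit.app X) ((root J).map (fillProj J α))

/-- `Fib*(α)` lives over `X`. -/
abbrev fibStarProj : FibStar J α ⟶ X :=
  pullback.fst ((Adjunction.ofIsLeftAdjoint (path J)).unit.app X) ((root J).map (fillProj J α))

/-- The base `Fib = Σ (α : U), Fib*(α)` of the universal small uniform fibration. -/
abbrev Fib : Psh.{w} C := FibStar J (𝟙 (U.{w} C))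

/-- The underlying type `α` of `(α, f) : Fib`. -/
abbrev fibTy : Fib J ⟶ U.{w} C := fibStarProj J (𝟙 (U.{w} C))

end Fill

/-! ## Path types and the rules for identity types -/

variable (J)

/-- A choice, strictly stable under substitution, of path types: for each type `α` in context `Γ`
a type `x : α, y : α ⊢ α^I(x, y)` such that `Γ.α.α.α^I` is the path object of `Γ.α` in the slice
over `Γ`, that is, the pullback of `(Γ.α)^I ⟶ Γ^I` along the constant path map of `Γ`, with
`x` and `y` the two endpoints. -/
structure PathTypes where
  ty : ∀ {Γ : Psh.{w} C} (α : Γ ⟶ U.{w} C), ext₂ α ⟶ U.{w} C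
  paths : ∀ {Γ : Psh.{w} C} (α : Γ ⟶ U.{w} C), ext (ty α) ⟶ (path J).obj (ext α)
  isPullback : ∀ {Γ : Psh.{w} C} (α : Γ ⟶ U.{w} C),
    IsPullback (paths α) (proj (ty α) ≫ fstVar α ≫ proj α) ((path J).map (proj α)) (const J Γ)
  source : ∀ {Γ : Psh.{w} C} (α : Γ ⟶ U.{w} C),
    paths α ≫ evAt J false (ext α) = proj (ty α) ≫ fstVar α
  target : ∀ {Γ : Psh.{w} C} (α : Γ ⟶ U.{w} C),
    paths α ≫ evAt J true (ext α) = proj (ty α) ≫ sndVar α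
  ty_subst : ∀ {Γ Δ : Psh.{w} C} {α : Γ ⟶ U.{w} C} {β : Δ ⟶ U.{w} C} (σ : Δ ⟶ Γ) (h : σ ≫ α = β),
    ext₂Map σ h ≫ ty α = ty β
  paths_subst : ∀ {Γ Δ : Psh.{w} C} {α : Γ ⟶ U.{w} C} {β : Δ ⟶ U.{w} C} (σ : Δ ⟶ Γ) (h : σ ≫ α = β),
    extMap (ext₂Map σ h) (ty_subst σ h) ≫ paths α = paths β ≫ (path J).map (extMap σ h)

namespace PathTypes

variable {J} (P : PathTypes J)

/-- The substitution between the contexts `x y : α(σ), z : α(σ)^I(x, y)` and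
`x y : α, z : α^I(x, y)` over `σ`. -/
abbrev idMap {Γ Δ : Psh.{w} C} {α : Γ ⟶ U.{w} C} {β : Δ ⟶ U.{w} C} (σ : Δ ⟶ Γ) (h : σ ≫ α = β) :
    ext (P.ty β) ⟶ ext (P.ty α) :=
  extMap (ext₂Map σ h) (P.ty_subst σ h)

/-- Formation rule: if `A` is a fibrant type, then so is `x : A, y : A ⊢ A^I(x, y)`; the fibration
structure is strictly stable under substitution. -/
structure Formation [J.IsTiny] where
  form : ∀ {Γ : Psh.{w} C} (A : Γ ⟶ Fib J), ext₂ (A ≫ fibTy J) ⟶ Fib J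
  form_ty : ∀ {Γ : Psh.{w} C} (A : Γ ⟶ Fib J), form A ≫ fibTy J = P.ty (A ≫ fibTy J)
  form_subst : ∀ {Γ Δ : Psh.{w} C} (A : Γ ⟶ Fib J) (σ : Δ ⟶ Γ),
    ext₂Map σ (Category.assoc σ A (fibTy J)).symm ≫ form A = form (σ ≫ A)

/-- Introduction rule: there is a term `x : α ⊢ con(x) : α^I(x, x)`, which is the constant path. -/
structure Introduction where
  con : ∀ {Γ : Psh.{w} C} (α : Γ ⟶ U.{w} C), ext α ⟶ E.{w} C
  con_type : ∀ {Γ : Psh.{w} C} (α : Γ ⟶ U.{w} C), con α ≫ disp.{w} C = diag α ≫ P.ty α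
  con_paths : ∀ {Γ : Psh.{w} C} (α : Γ ⟶ U.{w} C),
    pair (diag α) (con α) (con_type α) ≫ P.paths α = const J (ext α)

variable {P} (N : P.Introduction)

/-- The constant path map `Γ.α ⟶ Γ.α.α.α^I`, sending `x` to `(x, x, con(x))`. -/
abbrev Introduction.map {Γ : Psh.{w} C} (α : Γ ⟶ U.{w} C) : ext α ⟶ ext (P.ty α) :=
  pair (diag α) (N.con α) (N.con_type α)

/-- Elimination rule, for the fibrant types `A` satisfying `Q`: for each fibrant
`x y : A, z : A^I(x, y) ⊢ B(x, y, z)` and each `x : A ⊢ b(x) : B(x, x, con(x))` there is a term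
`x y : A, z : A^I(x, y) ⊢ j_b(x, y, z) : B(x, y, z)`, strictly stable under substitution. -/
structure Introduction.Elimination [J.IsTiny] (Q : ∀ {Γ : Psh.{w} C}, (Γ ⟶ Fib J) → Prop) where
  j : ∀ {Γ : Psh.{w} C} (A : Γ ⟶ Fib J), Q A →
    ∀ (B : ext (P.ty (A ≫ fibTy J)) ⟶ Fib J) (b : ext (A ≫ fibTy J) ⟶ E.{w} C),
      b ≫ disp.{w} C = N.map (A ≫ fibTy J) ≫ B ≫ fibTy J → (ext (P.ty (A ≫ fibTy J)) ⟶ E.{w} C)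
  j_type : ∀ {Γ : Psh.{w} C} (A : Γ ⟶ Fib J) (hA : Q A)
    (B : ext (P.ty (A ≫ fibTy J)) ⟶ Fib J) (b : ext (A ≫ fibTy J) ⟶ E.{w} C)
    (hb : b ≫ disp.{w} C = N.map (A ≫ fibTy J) ≫ B ≫ fibTy J),
    j A hA B b hb ≫ disp.{w} C = B ≫ fibTy J
  j_subst : ∀ {Γ Δ : Psh.{w} C} (σ : Δ ⟶ Γ) (A : Γ ⟶ Fib J) (hA : Q A) (hA' : Q (σ ≫ A))
    (B : ext (P.ty (A ≫ fibTy J)) ⟶ Fib J) (b : ext (A ≫ fibTy J) ⟶ E.{w} C)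
    (hb : b ≫ disp.{w} C = N.map (A ≫ fibTy J) ≫ B ≫ fibTy J)
    (hb' : (extMap σ (Category.assoc σ A (fibTy J)).symm ≫ b) ≫ disp.{w} C =
      N.map ((σ ≫ A) ≫ fibTy J) ≫
        (P.idMap σ (Category.assoc σ A (fibTy J)).symm ≫ B) ≫ fibTy J),
    P.idMap σ (Category.assoc σ A (fibTy J)).symm ≫ j A hA B b hb =
      j (σ ≫ A) hA' (P.idMap σ (Category.assoc σ A (fibTy J)).symm ≫ B)
        (extMap σ (Category.assoc σ A (fibTy J)).symm ≫ b) hb'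

/-- Computation rule: `x : A ⊢ j_b(x, x, con(x)) = b(x) : B(x, x, con(x))`. -/
def Introduction.Elimination.Computation {N : P.Introduction} [J.IsTiny]
    {Q : ∀ {Γ : Psh.{w} C}, (Γ ⟶ Fib J) → Prop}
    (L : N.Elimination Q) : Prop :=
  ∀ {Γ : Psh.{w} C} (A : Γ ⟶ Fib J) (hA : Q A)
    (B : ext (P.ty (A ≫ fibTy J)) ⟶ Fib J) (b : ext (A ≫ fibTy J) ⟶ E.{w} C)
    (hb : b ≫ disp.{w} C = N.map (A ≫ fibTy J) ≫ B ≫ fibTy J),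
    N.map (A ≫ fibTy J) ≫ L.j A hA B b hb = b

end PathTypes

end PshTT

end

/-!
Path types in a presheaf topos model identity types.

*Filling.* A map `A : Γ ⟶ Fib` amounts, by transposing along the tiny interval, to a type over `Γ`
together with a uniform operation that solves filling problems over representables
(`Filling.exists_fib`, `fibFilling`). Uniformity makes the fillers of the restrictions of a problem
over an arbitrary presheaf `Y` agree, so that they glue to a filler over `Y`, naturally in `Y`
(`Filling.boxFill`, `Filling.boxFill_restrict`). The remaining arguments can then be carried out
with generalized elements, and strict stability under substitution is naturality of the gluing.

*Path types.* The paths in `E` lying in a single fibre of `disp` form a presheaf over the pairs of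
elements of a type. Since the path functor is a left adjoint it preserves the presentation of the
cylinder `I × y c` as a colimit of representables, so the identity of the cylinder factors through
one of them: the cylinder is a retract of a representable (`exists_retract`). Hence there is only a
small set of paths with given endpoints, and the universe classifies these paths
(`isPullback_classifier`). All path types are restricted from this one, which makes them stable.

*Introduction, elimination, computation.* A map into `Γ.α.α.α^I` is a map into `Γ` with a family of
paths in `α` (`PathTypes.lift`, `PathTypes.hom_ext_term`). The connection contracts the paths with
a fixed source onto the constant path (`PathTypes.contraction`). The eliminator transports `b` along
this contraction in the fibrant family `B`; if the locus of constant paths is cofibrant, the filling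
problem can prescribe the transport to be constant there, which gives the computation rule. In
general one prescribes it on the empty subobject only. Both cases are `Locus.elimination`.

*Formation.* A filling problem for `α^I` over `Y` is a filling problem for `α` over `I × Y`, whose
partial element is given on the two ends and on the cylinder of the cofibration (`rim`). The
endpoints of the interval are distinct but not assumed disjoint; at stages where they coincide the
interval is trivial, and the pieces of the partial element agree there because of the element given
at the end of the cylinder (`PathTypes.rimTerm_some_some`). It is enough to treat the generic
fibrant type over `Fib`, which also gives stability.
-/

noncomputable section

namespace PshTT

variable {C : Type u} [Category.{v} C]

/-! ### Generalized elements and gluing -/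

lemma hom_ext_yo {X Y : Psh.{w} C} {f g : X ⟶ Y}
    (h : ∀ (d : C) (y : yo.{w}.obj d ⟶ X), y ≫ f = y ≫ g) : f = g :=
  hom_ext_uliftYoneda.{max (w + 1) u} h

/-- A family of maps with common target through which every generalized element with
representable domain factors. -/
def JointlySurjective {ι : Type*} {P : ι → Psh.{w} C} {S : Psh.{w} C} (m : ∀ i, P i ⟶ S) : Prop :=
  ∀ (d : C) (s : yo.{w}.obj d ⟶ S), ∃ (i : ι) (p : yo.{w}.obj d ⟶ P i), p ≫ m i = s

namespace JointlySurjective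

variable {ι : Type*} {P : ι → Psh.{w} C} {S W : Psh.{w} C} {m : ∀ i, P i ⟶ S}

lemma hom_ext (hm : JointlySurjective m) {f g : S ⟶ W} (h : ∀ i, m i ≫ f = m i ≫ g) : f = g :=
  hom_ext_yo fun d y => by
    obtain ⟨i, p, rfl⟩ := hm d y
    rw [Category.assoc, h, Category.assoc]

/-- Jointly surjective families of presheaf maps are effective. -/
lemma exists_glue (hm : JointlySurjective m) (f : ∀ i, P i ⟶ W)
    (compat : ∀ (d : C) (i j : ι) (p : yo.{w}.obj d ⟶ P i) (q : yo.{w}.obj d ⟶ P j),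
      p ≫ m i = q ≫ m j → p ≫ f i = q ≫ f j) :
    ∃ g : S ⟶ W, ∀ i, m i ≫ g = f i := by
  choose i p hp using hm
  have key : ∀ (d : C) (j : ι) (q : yo.{w}.obj d ⟶ P j),
      p d (q ≫ m j) ≫ f (i d (q ≫ m j)) = q ≫ f j := fun d j q => compat d _ _ _ _ (hp d _)
  have nat : ∀ (d e : C) (h : e ⟶ d) (s : yo.{w}.obj d ⟶ S),
      p e (yo.{w}.map h ≫ s) ≫ f _ = yo.{w}.map h ≫ p d s ≫ f _ := fun d e h s => by
    rw [← Category.assoc]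
    refine compat _ _ _ _ _ ?_
    rw [hp, Category.assoc, hp]
  refine ⟨{ app := fun d => ↾ fun s =>
              uliftYonedaEquiv (p d.unop (uliftYonedaEquiv.symm s) ≫ f _)
            naturality := ?_ }, fun j => hom_ext_yo fun d q => ?_⟩
  · intro d e h
    ext s
    have := nat d.unop e.unop h.unop (uliftYonedaEquiv.symm s)
    change uliftYonedaEquiv (p e.unop (uliftYonedaEquiv.symm (S.map h s)) ≫ f _) =
      W.map h (uliftYonedaEquiv (p d.unop (uliftYonedaEquiv.symm s) ≫ f _))
    rw [uliftYonedaEquiv_symm_map, this]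
    exact (uliftYonedaEquiv_naturality _ h).symm
  · apply uliftYonedaEquiv.injective
    rw [← key, ← Category.assoc, uliftYonedaEquiv_comp]
    change uliftYonedaEquiv (p d (uliftYonedaEquiv.symm (uliftYonedaEquiv (q ≫ m j))) ≫ f _) = _
    rw [Equiv.symm_apply_apply]

variable (I : Psh.{w} C)

/-- Joint surjectivity is preserved by products with `I`; this is seen by transposing. -/
lemma whiskerLeft_hom_ext (hm : JointlySurjective m) {f g : I ⊗ S ⟶ W}
    (h : ∀ i, I ◁ m i ≫ f = I ◁ m i ≫ g) : f = g := by
  apply MonoidalClosed.curry_injective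
  refine hm.hom_ext fun i => ?_
  rw [← MonoidalClosed.curry_natural_left, h, MonoidalClosed.curry_natural_left]

lemma exists_whiskerLeft_glue (hm : JointlySurjective m) (f : ∀ i, I ⊗ P i ⟶ W)
    (compat : ∀ (d : C) (i j : ι) (p : yo.{w}.obj d ⟶ P i) (q : yo.{w}.obj d ⟶ P j),
      p ≫ m i = q ≫ m j → I ◁ p ≫ f i = I ◁ q ≫ f j) :
    ∃ g : I ⊗ S ⟶ W, ∀ i, I ◁ m i ≫ g = f i := by
  obtain ⟨g, hg⟩ := hm.exists_glue (fun i => MonoidalClosed.curry (f i)) fun d i j p q h => by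
    rw [← MonoidalClosed.curry_natural_left, compat d i j p q h,
      MonoidalClosed.curry_natural_left]
  refine ⟨MonoidalClosed.uncurry g, fun i => ?_⟩
  rw [← MonoidalClosed.uncurry_natural_left, hg, MonoidalClosed.uncurry_curry]

end JointlySurjective

/-- Every presheaf is covered by its generalized elements with representable domain. -/
lemma jointlySurjective_yo (Y : Psh.{w} C) :
    JointlySurjective (fun y : Σ d : C, (yo.{w}.obj d ⟶ Y) => y.2) :=
  fun d s => ⟨⟨d, s⟩, 𝟙 _, Category.id_comp _⟩

variable {Cof : CofibrationClass.{w} C} {J : Interval Cof}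

/-! ### Filling problems over arbitrary presheaves -/

variable (J) in
/-- A filling problem for a type `β` over the cylinder `I × Y` on an arbitrary presheaf `Y`; for
representable `Y` this is a `Problem`. -/
structure Box (k : Bool) {Y : Psh.{w} C} (β : J.I ⊗ Y ⟶ U.{w} C) where
  φ : Subfunctor Y
  cof : Cof.cof φ.ι
  v : J.I ⊗ φ.toFunctor ⟶ E.{w} C
  a : Y ⟶ E.{w} C
  v_type : v ≫ disp.{w} C = J.I ◁ φ.ι ≫ β
  a_type : a ≫ disp.{w} C = endpt J k _ ≫ β
  compat : endpt J k _ ≫ v = φ.ι ≫ a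

namespace Box

variable {k : Bool} {Y Z W : Psh.{w} C} {β : J.I ⊗ Y ⟶ U.{w} C} {β' : J.I ⊗ Z ⟶ U.{w} C}

/-- Equality of filling problems without transport of the partial elements: they are compared along
the inclusion of one subobject in the other. -/
lemma ext {P Q : Box J k β} (hφ : P.φ = Q.φ)
    (hv : ∀ h : P.φ ≤ Q.φ, J.I ◁ Subfunctor.homOfLe h ≫ Q.v = P.v) (ha : P.a = Q.a) : P = Q := by
  obtain ⟨φ, _, v, a, _, _, _⟩ := P
  obtain ⟨φ', _, v', a', _, _, _⟩ := Q
  obtain rfl : φ = φ' := hφ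
  obtain rfl : a = a' := ha
  obtain rfl : v' = v := by
    exact (whiskerLeft_id_assoc _ _ _).symm.trans (hv le_rfl)
  rfl

/-- A filling problem over a representable. -/
def toProblem {d : C} {β : J.I ⊗ yo.{w}.obj d ⟶ U.{w} C} (P : Box J k β) : Problem J k β :=
  { P with }

/-- A filling problem over a representable, as one over a presheaf. -/
def ofProblem {d : C} {β : J.I ⊗ yo.{w}.obj d ⟶ U.{w} C} (P : Problem J k β) : Box J k β :=
  { P with }

/-- Restriction of a filling problem along `g : Z ⟶ Y`. -/
def restrict (P : Box J k β) (g : Z ⟶ Y) (h : J.I ◁ g ≫ β = β') : Box J k β' where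
  φ := P.φ.preimage g
  cof := cof_preimage _ _ P.cof
  v := J.I ◁ P.φ.fromPreimage g ≫ P.v
  a := g ≫ P.a
  v_type := by
    rw [Category.assoc, P.v_type, ← h, ← whiskerLeft_comp_assoc, ← whiskerLeft_comp_assoc,
      Subfunctor.fromPreimage_ι]
  a_type := by
    rw [Category.assoc, P.a_type, ← h, ← Category.assoc, ← Category.assoc, endpt_naturality]
  compat := by
    rw [← Category.assoc, endpt_naturality, Category.assoc, P.compat, ← Category.assoc,
      ← Category.assoc, Subfunctor.fromPreimage_ι]

lemma eq_restrict {P : Box J k β} {Q : Box J k β'} {g : Z ⟶ Y} (h : J.I ◁ g ≫ β = β')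
    (hφ : Q.φ = P.φ.preimage g)
    (hv : ∀ i : Q.φ.toFunctor ⟶ P.φ.toFunctor, i ≫ P.φ.ι = Q.φ.ι ≫ g → J.I ◁ i ≫ P.v = Q.v)
    (ha : Q.a = g ≫ P.a) : Q = P.restrict g h := by
  refine Box.ext hφ (fun hle => ?_) ha
  refine Eq.trans ?_ (hv (Subfunctor.homOfLe hle ≫ P.φ.fromPreimage g) rfl)
  exact (whiskerLeft_comp_assoc _ _ _ _).symm

lemma restrict_restrict (P : Box J k β) (g : Z ⟶ Y) (h : J.I ◁ g ≫ β = β') (f : W ⟶ Z)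
    {β'' : J.I ⊗ W ⟶ U.{w} C} (h' : J.I ◁ f ≫ β' = β'') :
    (P.restrict g h).restrict f h' =
      P.restrict (f ≫ g) (by rw [whiskerLeft_comp_assoc, h, h']) := by
  refine Box.ext rfl (fun _ => ?_) (Category.assoc _ _ _).symm
  exact (whiskerLeft_comp_assoc J.I (Subfunctor.homOfLe _) (P.φ.fromPreimage (f ≫ g)) P.v).symm.trans
    (whiskerLeft_comp_assoc J.I ((P.φ.preimage g).fromPreimage f) (P.φ.fromPreimage g) P.v)

end Box

/-- A filling operation on a type `α` over `Γ`: fillers for the restrictions of `α` along all maps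
`I × y d ⟶ Γ`, uniformly in `d`. The restriction is recorded as a type `β` with a proof that it is
the restriction of `α`, so that no transport of problems is needed. -/
structure Filling (J : Interval Cof) {Γ : Psh.{w} C} (α : Γ ⟶ U.{w} C) where
  fill : ∀ (k : Bool) {d : C} (x : J.I ⊗ yo.{w}.obj d ⟶ Γ) {β : J.I ⊗ yo.{w}.obj d ⟶ U.{w} C},
    x ≫ α = β → Problem J k β → (J.I ⊗ yo.{w}.obj d ⟶ E.{w} C)
  fill_type : ∀ (k : Bool) {d : C} (x : J.I ⊗ yo.{w}.obj d ⟶ Γ) {β : J.I ⊗ yo.{w}.obj d ⟶ U.{w} C}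
    (h : x ≫ α = β) (P : Problem J k β), fill k x h P ≫ disp.{w} C = β
  fill_endpt : ∀ (k : Bool) {d : C} (x : J.I ⊗ yo.{w}.obj d ⟶ Γ)
    {β : J.I ⊗ yo.{w}.obj d ⟶ U.{w} C} (h : x ≫ α = β) (P : Problem J k β),
    endpt J k _ ≫ fill k x h P = P.a
  fill_partial : ∀ (k : Bool) {d : C} (x : J.I ⊗ yo.{w}.obj d ⟶ Γ)
    {β : J.I ⊗ yo.{w}.obj d ⟶ U.{w} C} (h : x ≫ α = β) (P : Problem J k β),
    J.I ◁ P.φ.ι ≫ fill k x h P = P.v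
  uniform : ∀ (k : Bool) {d e : C} (x : J.I ⊗ yo.{w}.obj d ⟶ Γ)
    {β : J.I ⊗ yo.{w}.obj d ⟶ U.{w} C} (h : x ≫ α = β) (P : Problem J k β) (g : e ⟶ d)
    (x' : J.I ⊗ yo.{w}.obj e ⟶ Γ) {β' : J.I ⊗ yo.{w}.obj e ⟶ U.{w} C} (h' : x' ≫ α = β')
    (hβ : J.I ◁ yo.{w}.map g ≫ β = β'), J.I ◁ yo.{w}.map g ≫ x = x' →
    fill k x' h' (P.restrict g hβ) = J.I ◁ yo.{w}.map g ≫ fill k x h P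

namespace Filling

variable {Γ : Psh.{w} C} {α : Γ ⟶ U.{w} C} (F : Filling J α)

/-- By uniformity, the fillers of the restrictions of a problem to representables are compatible. -/
lemma exists_boxFill (k : Bool) {Y : Psh.{w} C} (x : J.I ⊗ Y ⟶ Γ) {β : J.I ⊗ Y ⟶ U.{w} C}
    (h : x ≫ α = β) (P : Box J k β) :
    ∃ r : J.I ⊗ Y ⟶ E.{w} C, ∀ (d : C) (y : yo.{w}.obj d ⟶ Y),
      J.I ◁ y ≫ r = F.fill k (J.I ◁ y ≫ x) (by rw [Category.assoc, h])
        (P.restrict y rfl).toProblem := by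
  obtain ⟨r, hr⟩ := (jointlySurjective_yo Y).exists_whiskerLeft_glue J.I
    (fun y => F.fill k (J.I ◁ y.2 ≫ x) (by rw [Category.assoc, h]) (P.restrict y.2 rfl).toProblem)
    (by
      have key : ∀ (e d : C) (y : yo.{w}.obj d ⟶ Y) (p : yo.{w}.obj e ⟶ yo.{w}.obj d),
          J.I ◁ p ≫ F.fill k (J.I ◁ y ≫ x) (by rw [Category.assoc, h])
            (P.restrict y rfl).toProblem =
          F.fill k (J.I ◁ (p ≫ y) ≫ x) (by rw [Category.assoc, h])
            (P.restrict (p ≫ y) rfl).toProblem := by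
        intro e d y p
        obtain ⟨g, rfl⟩ := yo.{w}.map_surjective p
        rw [← F.uniform k (J.I ◁ y ≫ x) _ (P.restrict y rfl).toProblem g
          (J.I ◁ (yo.{w}.map g ≫ y) ≫ x) (by rw [Category.assoc, h])
          (by simp only [whiskerLeft_comp_assoc]) (by rw [whiskerLeft_comp_assoc])]
        congr 1
      rintro e ⟨d, y⟩ ⟨d', y'⟩ p q hpq
      dsimp only at p q hpq ⊢
      rw [key, key]
      generalize p ≫ y = z at hpq
      subst hpq
      rfl)
  exact ⟨r, fun d y => hr ⟨d, y⟩⟩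

/-- The filler of a filling problem over an arbitrary presheaf, glued from the fillers over its
generalized elements. -/
def boxFill (k : Bool) {Y : Psh.{w} C} (x : J.I ⊗ Y ⟶ Γ) {β : J.I ⊗ Y ⟶ U.{w} C}
    (h : x ≫ α = β) (P : Box J k β) : J.I ⊗ Y ⟶ E.{w} C :=
  (F.exists_boxFill k x h P).choose

section

variable (k : Bool) {Y Z : Psh.{w} C} (x : J.I ⊗ Y ⟶ Γ) {β : J.I ⊗ Y ⟶ U.{w} C}
  (h : x ≫ α = β) (P : Box J k β)

lemma whiskerLeft_boxFill {d : C} (y : yo.{w}.obj d ⟶ Y) :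
    J.I ◁ y ≫ F.boxFill k x h P = F.fill k (J.I ◁ y ≫ x) (by rw [Category.assoc, h])
      (P.restrict y rfl).toProblem :=
  (F.exists_boxFill k x h P).choose_spec d y

lemma boxFill_type : F.boxFill k x h P ≫ disp.{w} C = β := by
  refine (jointlySurjective_yo Y).whiskerLeft_hom_ext J.I fun y => ?_
  rw [← Category.assoc, whiskerLeft_boxFill, fill_type]

lemma endpt_boxFill : endpt J k Y ≫ F.boxFill k x h P = P.a := by
  refine hom_ext_yo fun d y => ?_
  rw [← Category.assoc, ← endpt_naturality, Category.assoc, whiskerLeft_boxFill, fill_endpt]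
  rfl

lemma whiskerLeft_ι_boxFill : J.I ◁ P.φ.ι ≫ F.boxFill k x h P = P.v := by
  refine (jointlySurjective_yo P.φ.toFunctor).whiskerLeft_hom_ext J.I fun ⟨d, y⟩ => ?_
  dsimp only at y ⊢
  rw [← whiskerLeft_comp_assoc, whiskerLeft_boxFill]
  -- `y` factors through the domain of the restricted problem, which is all of `yo d`
  let s : yo.{w}.obj d ⟶ (P.φ.preimage (y ≫ P.φ.ι)).toFunctor :=
    Subfunctor.lift (𝟙 _) (by rintro c _ ⟨z, rfl⟩; exact (y.app c z).2)
  have h₁ : s ≫ (P.φ.preimage (y ≫ P.φ.ι)).ι = 𝟙 _ := rfl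
  have h₂ : s ≫ P.φ.fromPreimage (y ≫ P.φ.ι) = y := rfl
  have := F.fill_partial k (J.I ◁ (y ≫ P.φ.ι) ≫ x) (by rw [Category.assoc, h])
    (P.restrict (y ≫ P.φ.ι) rfl).toProblem
  have := congr_arg (J.I ◁ s ≫ ·) this
  dsimp only [Box.toProblem, Box.restrict] at this
  rw [← whiskerLeft_comp_assoc, h₁, whiskerLeft_id, Category.id_comp,
    ← whiskerLeft_comp_assoc, h₂] at this
  exact this

/-- The fillers over arbitrary presheaves are natural, since glued maps are determined by their
restrictions to representables. -/
lemma boxFill_restrict (g : Z ⟶ Y) {x' : J.I ⊗ Z ⟶ Γ} (hx : J.I ◁ g ≫ x = x')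
    {β' : J.I ⊗ Z ⟶ U.{w} C} (h' : x' ≫ α = β') (Q : Box J k β')
    (hβ : J.I ◁ g ≫ β = β') (hQ : Q = P.restrict g hβ) :
    F.boxFill k x' h' Q = J.I ◁ g ≫ F.boxFill k x h P := by
  subst hQ hx hβ
  refine (jointlySurjective_yo Z).whiskerLeft_hom_ext J.I fun ⟨d, y⟩ => ?_
  dsimp only at y ⊢
  rw [← whiskerLeft_comp_assoc, whiskerLeft_boxFill, whiskerLeft_boxFill,
    P.restrict_restrict g rfl y rfl]
  congr 1

end

end Filling

section Elem

variable {Γ : Psh.{w} C} {α : Γ ⟶ U.{w} C} (F : Filling J α)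

lemma Filling.fill_congr (k : Bool) {d : C} {x x' : J.I ⊗ yo.{w}.obj d ⟶ Γ}
    {β β' : J.I ⊗ yo.{w}.obj d ⟶ U.{w} C} (h : x ≫ α = β) (h' : x' ≫ α = β') (hx : x = x')
    (hβ : β = β') (P : Problem J k β) : F.fill k x h P = F.fill k x' h' (P.cast hβ) := by
  subst hx hβ
  rfl

/-- The element of `Fill` determined by a filling operation and a path in its base. -/
def Filling.elem {d : C} (x : J.I ⊗ yo.{w}.obj d ⟶ Γ) : FillElem (𝟙 (U.{w} C)) J d where
  x := x ≫ α
  str k :=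
    { fill := fun f P => F.fill k (J.I ◁ yo.{w}.map f ≫ x) (by simp) P
      fill_type := fun f P => F.fill_type _ _ _ _
      fill_endpt := fun f P => F.fill_endpt _ _ _ _
      fill_partial := fun f P => F.fill_partial _ _ _ _
      uniform := fun f g l h P => F.uniform k _ _ P g _ _ _
        (by rw [← h, Functor.map_comp, whiskerLeft_comp_assoc]) }

lemma Filling.elem_restrict {d e : C} (x : J.I ⊗ yo.{w}.obj d ⟶ Γ) (g : e ⟶ d) :
    F.elem (J.I ◁ yo.{w}.map g ≫ x) = (F.elem x).restrict _ g := by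
  refine FillElem.ext' (Category.assoc _ _ _) fun k c f P => ?_
  exact F.fill_congr k _ _ (by rw [Functor.map_comp, whiskerLeft_comp_assoc])
    (by
      change J.I ◁ yo.{w}.map f ≫ ((J.I ◁ yo.{w}.map g ≫ x) ≫ α) ≫ 𝟙 _ =
        J.I ◁ yo.{w}.map (f ≫ g) ≫ (x ≫ α) ≫ 𝟙 _
      simp) P

end Elem

/-! ### Maps into the universal fibration and filling operations -/

section Fib

variable [J.IsTiny]

variable (J) in
/-- The transpose of the universal fibration structure. -/
def fibTranspose : (path J).obj (Fib J) ⟶ Fill J (𝟙 (U.{w} C)) :=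
  ((Adjunction.ofIsLeftAdjoint (path J)).homEquiv _ _).symm (pullback.snd _ _)

/-- The transpose of the defining square of `Fib`. -/
lemma fibTranspose_fillProj :
    fibTranspose J ≫ fillProj J (𝟙 (U.{w} C)) = (path J).map (fibTy J) := by
  rw [fibTranspose, ← Adjunction.homEquiv_naturality_right_symm, Equiv.symm_apply_eq,
    ← pullback.condition, Adjunction.homEquiv_unit, Adjunction.unit_naturality]

/-- A type with a filling operation underlies a map into the universal fibration. -/
lemma Filling.exists_fib {Γ : Psh.{w} C} {α : Γ ⟶ U.{w} C} (F : Filling J α) :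
    ∃ A : Γ ⟶ Fib J, A ≫ fibTy J = α := by
  -- the transpose of the required map acts on paths by `Filling.elem`
  let t : (path J).obj Γ ⟶ Fill J (𝟙 (U.{w} C)) :=
    { app := fun d => ↾ fun p => F.elem (MonoidalClosed.uncurry (uliftYonedaEquiv.symm p))
      naturality := fun d e g => by
        ext p
        change F.elem (MonoidalClosed.uncurry (uliftYonedaEquiv.symm (((path J).obj Γ).map g p))) =
          (F.elem (MonoidalClosed.uncurry (uliftYonedaEquiv.symm p))).restrict _ g.unop
        rw [uliftYonedaEquiv_symm_map, MonoidalClosed.uncurry_natural_left]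
        exact F.elem_restrict _ _ }
  have ht : t ≫ fillProj J (𝟙 (U.{w} C)) = (path J).map α := by
    ext d p
    change uliftYonedaEquiv (MonoidalClosed.curry
      (MonoidalClosed.uncurry (uliftYonedaEquiv.symm p) ≫ α)) = ((path J).map α).app d p
    rw [MonoidalClosed.curry_natural_right, MonoidalClosed.curry_uncurry, uliftYonedaEquiv_comp,
      Equiv.apply_symm_apply]
  refine ⟨pullback.lift α ((Adjunction.ofIsLeftAdjoint (path J)).homEquiv _ _ t) ?_,
    pullback.lift_fst _ _ _⟩
  rw [← Adjunction.homEquiv_naturality_right, ht, Adjunction.homEquiv_unit,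
    Adjunction.unit_naturality]

/-- The element of `Fill` at stage `d` determined by a path in `Fib`. -/
def fibElem {d : C} (x : J.I ⊗ yo.{w}.obj d ⟶ Fib J) : FillElem (𝟙 (U.{w} C)) J d :=
  (fibTranspose J).app (op d) (uliftYonedaEquiv (MonoidalClosed.curry x))

lemma fibElem_x {d : C} (x : J.I ⊗ yo.{w}.obj d ⟶ Fib J) :
    (fibElem x).x = x ≫ fibTy J := by
  apply MonoidalClosed.curry_injective
  apply uliftYonedaEquiv.injective
  rw [MonoidalClosed.curry_natural_right, uliftYonedaEquiv_comp, ← fibTranspose_fillProj]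
  rfl

lemma fibElem_restrict {d e : C} (x : J.I ⊗ yo.{w}.obj d ⟶ Fib J) (g : e ⟶ d) :
    fibElem (J.I ◁ yo.{w}.map g ≫ x) = (fibElem x).restrict _ g := by
  rw [fibElem, MonoidalClosed.curry_natural_left]
  erw [← uliftYonedaEquiv_naturality (X := op d) (Y := op e) _ g.op]
  exact NatTrans.naturality_apply (fibTranspose J) g.op _

variable (J) in
/-- The generic filling operation, on the universal fibrant type. -/
def fibFilling : Filling J (fibTy J) where
  fill k d x β h P := ((fibElem x).str k).fill (𝟙 d) (P.cast (by simp [fibElem_x, h]))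
  fill_type k d x β h P := (((fibElem x).str k).fill_type (𝟙 d) _).trans (by simp [fibElem_x, h])
  fill_endpt k d x β h P := ((fibElem x).str k).fill_endpt (𝟙 d)
    (P.cast (by simp [fibElem_x, h]))
  fill_partial k d x β h P := ((fibElem x).str k).fill_partial (𝟙 d)
    (P.cast (by simp [fibElem_x, h]))
  uniform k d e x β h P g x' β' h' hβ hx := by
    subst hx hβ h
    -- `fibElem_restrict` equates elements with different dependent types of problems, so it is
    -- substituted in a statement about an arbitrary element `s`
    have key : ∀ (s : FillElem (𝟙 (U.{w} C)) J e) (hs : s = (fibElem x).restrict _ g)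
        (Q : Problem J k (J.I ◁ yo.{w}.map (𝟙 e) ≫ s.x ≫ 𝟙 (U.{w} C)))
        (Q' : Problem J k (J.I ◁ yo.{w}.map (𝟙 e ≫ g) ≫ (fibElem x).x ≫ 𝟙 (U.{w} C))),
        Q' = Q.cast (by rw [hs]; simp [FillElem.restrict]) →
        (s.str k).fill (𝟙 e) Q = ((fibElem x).str k).fill (𝟙 e ≫ g) Q' := by
      rintro _ rfl Q _ rfl
      rfl
    have hP : J.I ◁ yo.{w}.map (𝟙 d) ≫ (fibElem x).x ≫ 𝟙 (U.{w} C) = x ≫ fibTy J := by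
      simp [fibElem_x]
    have h₁ := ((fibElem x).str k).uniform (𝟙 d) g (𝟙 e ≫ g) (by simp) (P.cast hP.symm)
    have h₂ := key _ (fibElem_restrict x g)
      ((P.restrict g rfl).cast (by rw [fibElem_x]; simp)) _ rfl
    exact h₂.trans h₁

end Fib

/-! ### Elements of path types as paths of elements -/

section Variables

variable {Γ Δ Z : Psh.{w} C}

lemma ext_hom_ext {α : Γ ⟶ U.{w} C} {f g : Z ⟶ ext α} (h₁ : f ≫ proj α = g ≫ proj α)
    (h₂ : f ≫ var α = g ≫ var α) : f = g :=
  pullback.hom_ext h₁ h₂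

lemma proj_comp (α : Γ ⟶ U.{w} C) : proj α ≫ α = var α ≫ disp.{w} C := pullback.condition

/-- The variable of `x, y : α` indexed by the endpoint `k` of a path from `x` to `y`. -/
def endVar (k : Bool) (α : Γ ⟶ U.{w} C) : ext₂ α ⟶ ext α := bif k then sndVar α else fstVar α

lemma endVar_proj (k : Bool) (α : Γ ⟶ U.{w} C) : endVar k α ≫ proj α = fstVar α ≫ proj α := by
  cases k
  · rfl
  · exact extMap_proj (proj α) rfl

lemma sndVar_var (α : Γ ⟶ U.{w} C) : sndVar α ≫ var α = var (proj α ≫ α) :=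
  pullback.lift_snd _ _ _

/-- A map into `Γ.α.α` is determined by its component in `Γ` and its two variables. -/
lemma ext₂_hom_ext {α : Γ ⟶ U.{w} C} {f g : Z ⟶ ext₂ α}
    (h : f ≫ fstVar α ≫ proj α = g ≫ fstVar α ≫ proj α)
    (h' : ∀ k, f ≫ endVar k α ≫ var α = g ≫ endVar k α ≫ var α) : f = g := by
  have h₀ := h' false
  have h₁ := h' true
  simp only [endVar, cond_true, cond_false, sndVar_var] at h₀ h₁
  exact ext_hom_ext (ext_hom_ext (by simpa using h) (by simpa using h₀)) h₁

lemma diag_endVar (k : Bool) (α : Γ ⟶ U.{w} C) : diag α ≫ endVar k α = 𝟙 _ := by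
  have h : diag α ≫ fstVar α = 𝟙 _ := pullback.lift_fst _ _ _
  cases k
  · exact h
  · refine ext_hom_ext ?_ ?_
    · rw [Category.assoc, endVar_proj, ← Category.assoc, h]
    · change (diag α ≫ sndVar α) ≫ _ = _
      rw [Category.assoc, sndVar_var, Category.id_comp]
      exact pullback.lift_snd _ _ _

lemma extMap_var {α : Γ ⟶ U.{w} C} {β : Δ ⟶ U.{w} C} (σ : Δ ⟶ Γ) (h : σ ≫ α = β) :
    extMap σ h ≫ var α = var β := pullback.lift_snd _ _ _

lemma ext₂Map_endVar (k : Bool) {α : Γ ⟶ U.{w} C} {β : Δ ⟶ U.{w} C} (σ : Δ ⟶ Γ) (h : σ ≫ α = β) :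
    ext₂Map σ h ≫ endVar k α = endVar k β ≫ extMap σ h := by
  cases k
  · exact extMap_proj _ _
  · change ext₂Map σ h ≫ sndVar α = sndVar β ≫ extMap σ h
    refine ext_hom_ext ?_ ?_
    · simp only [Category.assoc, extMap_proj]
      rw [← Category.assoc, extMap_proj, Category.assoc, extMap_proj, ← Category.assoc,
        ← Category.assoc, extMap_proj]
    · rw [Category.assoc, Category.assoc, sndVar_var, extMap_var, extMap_var, sndVar_var]

end Variables

lemma endpt_snd (k : Bool) (Z : Psh.{w} C) : endpt J k Z ≫ snd _ _ = 𝟙 Z := lift_snd _ _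

lemma uncurry_const (X : Psh.{w} C) : MonoidalClosed.uncurry (const J X) = snd _ _ :=
  MonoidalClosed.uncurry_curry _

namespace PathTypes

variable (P : PathTypes J) {Γ Δ Z W : Psh.{w} C} {α : Γ ⟶ U.{w} C}

/-- The projection of the context `x y : α, z : α^I(x, y)` to `Γ`. -/
def base (α : Γ ⟶ U.{w} C) : ext (P.ty α) ⟶ Γ := proj (P.ty α) ≫ fstVar α ≫ proj α

lemma paths_evAt (k : Bool) (α : Γ ⟶ U.{w} C) :
    P.paths α ≫ evAt J k (ext α) = proj (P.ty α) ≫ endVar k α := by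
  cases k
  · exact P.source α
  · exact P.target α

lemma uncurry_proj (t : Z ⟶ ext (P.ty α)) :
    MonoidalClosed.uncurry (t ≫ P.paths α) ≫ proj α = snd _ _ ≫ t ≫ P.base α := by
  rw [← MonoidalClosed.uncurry_natural_right, Category.assoc, (P.isPullback α).w,
    ← Category.assoc, MonoidalClosed.uncurry_natural_left, uncurry_const, whiskerLeft_snd]
  rfl

/-- The family of elements of `α` underlying a family of elements of the path type. -/
def term (t : Z ⟶ ext (P.ty α)) : J.I ⊗ Z ⟶ E.{w} C :=
  MonoidalClosed.uncurry (t ≫ P.paths α) ≫ var α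

lemma term_type (t : Z ⟶ ext (P.ty α)) :
    P.term t ≫ disp.{w} C = snd _ _ ≫ t ≫ P.base α ≫ α := by
  rw [term, Category.assoc, ← proj_comp, ← Category.assoc, uncurry_proj]
  simp only [Category.assoc]

lemma term_comp (f : W ⟶ Z) (t : Z ⟶ ext (P.ty α)) : P.term (f ≫ t) = J.I ◁ f ≫ P.term t := by
  rw [term, term, Category.assoc, MonoidalClosed.uncurry_natural_left, Category.assoc]

/-- The values of a path at the endpoints of the interval are the variables `x` and `y`. -/
lemma endpt_term (k : Bool) (t : Z ⟶ ext (P.ty α)) :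
    endpt J k Z ≫ P.term t = t ≫ proj (P.ty α) ≫ endVar k α ≫ var α := by
  have := P.paths_evAt k α
  rw [term, MonoidalClosed.uncurry_eq, Category.assoc, ← Category.assoc, endpt_naturality,
    ← Category.assoc (proj (P.ty α)), ← this]
  simp only [Category.assoc]

variable {P} in
/-- An element of a path type is determined by the path of elements underlying it. -/
lemma hom_ext_term {s t : Z ⟶ ext (P.ty α)} (h : s ≫ P.base α = t ≫ P.base α)
    (h' : P.term s = P.term t) : s = t := by
  refine (P.isPullback α).hom_ext (MonoidalClosed.uncurry_injective (ext_hom_ext ?_ h')) h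
  rw [uncurry_proj, uncurry_proj, h]

/-- The family of elements of the path type determined by a family of paths in `α`. -/
def lift (γ : Z ⟶ Γ) (p : J.I ⊗ Z ⟶ E.{w} C) (h : p ≫ disp.{w} C = snd _ _ ≫ γ ≫ α) :
    Z ⟶ ext (P.ty α) :=
  (P.isPullback α).lift
    (MonoidalClosed.curry (pair (snd _ _ ≫ γ) p (by rw [h, Category.assoc]))) γ (by
      rw [← MonoidalClosed.curry_natural_right, pullback.lift_fst,
        ← whiskerLeft_snd, MonoidalClosed.curry_natural_left])

section

variable (γ : Z ⟶ Γ) (p : J.I ⊗ Z ⟶ E.{w} C) (h : p ≫ disp.{w} C = snd _ _ ≫ γ ≫ α)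

lemma lift_base : P.lift γ p h ≫ P.base α = γ := (P.isPullback α).lift_snd _ _ _

lemma term_lift : P.term (P.lift γ p h) = p := by
  rw [term, lift, (P.isPullback α).lift_fst, MonoidalClosed.uncurry_curry]
  exact pullback.lift_snd _ _ _

end

section

variable {β : Δ ⟶ U.{w} C} (σ : Δ ⟶ Γ) (h : σ ≫ α = β)

lemma idMap_base : P.idMap σ h ≫ P.base α = P.base β ≫ σ := by
  rw [base, base, ← Category.assoc, extMap_proj, Category.assoc, ← Category.assoc (ext₂Map σ h),
    extMap_proj]
  simp only [Category.assoc, extMap_proj]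

lemma term_idMap (t : Z ⟶ ext (P.ty β)) : P.term (t ≫ P.idMap σ h) = P.term t := by
  rw [term, term, Category.assoc, P.paths_subst, ← Category.assoc,
    MonoidalClosed.uncurry_natural_right, Category.assoc, extMap_var]

end

/-- The constant paths. -/
lemma exists_introduction : Nonempty P.Introduction := by
  let n : ∀ {Γ : Psh.{w} C} (α : Γ ⟶ U.{w} C), ext α ⟶ ext (P.ty α) := fun α =>
    P.lift (proj α) (snd _ _ ≫ var α) (by rw [Category.assoc, ← proj_comp])
  have hn : ∀ {Γ : Psh.{w} C} (α : Γ ⟶ U.{w} C), n α ≫ proj (P.ty α) = diag α := fun α => by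
    refine ext₂_hom_ext ?_ fun k => ?_
    · rw [Category.assoc]
      refine (P.lift_base _ _ _).trans ?_
      rw [← Category.assoc]
      change _ = (diag α ≫ endVar false α) ≫ _
      rw [diag_endVar, Category.id_comp]
    · rw [Category.assoc, ← P.endpt_term, P.term_lift, ← Category.assoc, endpt_snd,
        ← Category.assoc, diag_endVar]
  have hn' : ∀ {Γ : Psh.{w} C} (α : Γ ⟶ U.{w} C),
      (n α ≫ var (P.ty α)) ≫ disp.{w} C = diag α ≫ P.ty α := fun α => by
    rw [← hn, Category.assoc, Category.assoc, proj_comp]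
  have hp : ∀ {Γ : Psh.{w} C} (α : Γ ⟶ U.{w} C),
      pair (diag α) (n α ≫ var (P.ty α)) (hn' α) = n α := fun α =>
    ext_hom_ext (by rw [pullback.lift_fst, hn]) (pullback.lift_snd _ _ _)
  refine ⟨fun α => n α ≫ var (P.ty α), hn', fun α => ?_⟩
  rw [hp]
  refine MonoidalClosed.uncurry_injective (ext_hom_ext ?_ ?_)
  · rw [uncurry_proj, P.lift_base, uncurry_const]
  · rw [uncurry_const]
    exact P.term_lift _ _ _

namespace Introduction

variable {P} (N : P.Introduction)

lemma map_base (α : Γ ⟶ U.{w} C) : N.map α ≫ P.base α = proj α := by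
  rw [base, ← Category.assoc, pullback.lift_fst, ← Category.assoc]
  change (diag α ≫ endVar false α) ≫ _ = _
  rw [diag_endVar, Category.id_comp]

lemma term_map (α : Γ ⟶ U.{w} C) : P.term (N.map α) = snd _ _ ≫ var α := by
  rw [term, N.con_paths, uncurry_const]

/-- Substitution commutes with the formation of constant paths. -/
lemma map_idMap {α : Γ ⟶ U.{w} C} {β : Δ ⟶ U.{w} C} (σ : Δ ⟶ Γ) (h : σ ≫ α = β) :
    N.map β ≫ P.idMap σ h = extMap σ h ≫ N.map α := by
  refine hom_ext_term ?_ ?_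
  · rw [Category.assoc, P.idMap_base, ← Category.assoc, map_base, Category.assoc, map_base,
      extMap_proj]
  · rw [P.term_idMap, term_map, P.term_comp, term_map, whiskerLeft_snd_assoc, extMap_var]

end Introduction

end PathTypes

/-! ### Elimination and computation -/

variable (J) in
/-- At time `δ k` the connection `(j, i) ↦ j ⊓ₖ i` is constant with value `δ k`. -/
lemma endpt_whiskerLeft_conn (k : Bool) (Z : Psh.{w} C) :
    J.I ◁ endpt J k Z ≫ lift (lift (fst _ _) (snd _ _ ≫ fst _ _) ≫ J.conn k) (snd _ _ ≫ snd _ _) =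
      snd J.I Z ≫ endpt J k Z := by
  have := fst J.I Z ≫= J.conn_right k
  simp only [comp_lift_assoc, Category.comp_id] at this
  ext1
  · simpa [← Category.assoc] using this
  · simp

variable (J) in
/-- At the other endpoint the connection `(j, i) ↦ j ⊓ₖ i` is the identity. -/
lemma endpt_not_whiskerLeft_conn (k : Bool) (Z : Psh.{w} C) :
    J.I ◁ endpt J (!k) Z ≫
      lift (lift (fst _ _) (snd _ _ ≫ fst _ _) ≫ J.conn k) (snd _ _ ≫ snd _ _) = 𝟙 (J.I ⊗ Z) := by
  have := fst J.I Z ≫= J.conn_right' k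
  simp only [comp_lift_assoc, Category.comp_id] at this
  ext1
  · simpa [← Category.assoc] using this
  · simp

/-- The empty subpresheaf is cofibrant. -/
lemma cof_bot (Y : Psh.{w} C) : Cof.cof (⊥ : Subfunctor Y).ι := by
  have hempty : ∀ c, IsEmpty ((⊥_ (Psh.{w} C)).obj c) := fun c =>
    ⟨fun x => ((initial.to (⊥ : Subfunctor Y).toFunctor).app c x).2⟩
  have hempty' : ∀ c, IsEmpty ((⊥ : Subfunctor Y).toFunctor.obj c) := fun c => ⟨fun x => x.2⟩
  let z : (⊥ : Subfunctor Y).toFunctor ⟶ ⊥_ (Psh.{w} C) :=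
    { app := fun c => ↾ fun x => ((hempty' c).false x).elim
      naturality := fun c d f => by
        ext x
        exact ((hempty' c).false x).elim }
  refine Cof.pullback (s := z) (m := initial.to (⊤_ (Psh.{w} C))) (t := terminal.from Y) ?_
    (Cof.initial _)
  -- a presheaf with a map to the initial one is empty
  have hz : ∀ {W : Psh.{w} C} (_ : W ⟶ ⊥_ (Psh.{w} C)) {V : Psh.{w} C} (f g : W ⟶ V), f = g :=
    fun e _ f g => by
      ext c x
      exact ((hempty c).false (e.app c x)).elim
  refine ⟨⟨hz z _ _⟩, ⟨PullbackCone.IsLimit.mk _ (fun s => s.fst ≫ initial.to _)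
    (fun s => hz s.fst _ _) (fun s => hz s.fst _ _) (fun s m _ _ => hz s.fst _ _)⟩⟩

namespace PathTypes

variable (P : PathTypes J) {Γ Δ Z : Psh.{w} C}

/-- The source of a path. -/
abbrev src (α : Γ ⟶ U.{w} C) : ext (P.ty α) ⟶ ext α := proj (P.ty α) ≫ fstVar α

lemma src_proj (α : Γ ⟶ U.{w} C) : P.src α ≫ proj α = P.base α := Category.assoc _ _ _

/-- The contraction of the space of paths with fixed source onto the constant path: at time `i` and
position `j` a path `z` is moved to `z (j ⊓ i)`. -/
def contraction (α : Γ ⟶ U.{w} C) : J.I ⊗ ext (P.ty α) ⟶ ext (P.ty α) :=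
  P.lift (snd _ _ ≫ P.base α)
    (CartesianMonoidalCategory.lift
      (CartesianMonoidalCategory.lift (fst _ _) (snd _ _ ≫ fst _ _) ≫ J.conn false)
      (snd _ _ ≫ snd _ _) ≫ P.term (𝟙 _))
    (by
      rw [Category.assoc, term_type, lift_snd_assoc]
      simp only [Category.assoc, Category.id_comp])

lemma contraction_base (α : Γ ⟶ U.{w} C) :
    P.contraction α ≫ P.base α = snd _ _ ≫ P.base α := P.lift_base _ _ _

lemma term_contraction (α : Γ ⟶ U.{w} C) : P.term (P.contraction α) =
    CartesianMonoidalCategory.lift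
      (CartesianMonoidalCategory.lift (fst _ _) (snd _ _ ≫ fst _ _) ≫ J.conn false)
      (snd _ _ ≫ snd _ _) ≫ P.term (𝟙 _) := P.term_lift _ _ _

/-- The contraction ends at the identity. -/
lemma endpt_true_contraction (α : Γ ⟶ U.{w} C) : endpt J true _ ≫ P.contraction α = 𝟙 _ := by
  refine hom_ext_term ?_ ?_
  · rw [Category.assoc, contraction_base, lift_snd_assoc]
  · rw [term_comp, term_contraction, ← Category.assoc]
    exact (congr_arg (· ≫ _) (endpt_not_whiskerLeft_conn J false _)).trans (Category.id_comp _)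

lemma contraction_idMap {α : Γ ⟶ U.{w} C} {β : Δ ⟶ U.{w} C} (σ : Δ ⟶ Γ) (h : σ ≫ α = β) :
    J.I ◁ P.idMap σ h ≫ P.contraction α = P.contraction β ≫ P.idMap σ h := by
  refine hom_ext_term ?_ ?_
  · rw [Category.assoc, contraction_base, whiskerLeft_snd_assoc, idMap_base, Category.assoc,
      idMap_base, ← Category.assoc (P.contraction β), contraction_base, Category.assoc]
  · rw [term_comp, term_contraction, term_idMap, term_contraction]
    have : P.term (𝟙 (ext (P.ty β))) = J.I ◁ P.idMap σ h ≫ P.term (𝟙 _) := by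
      rw [← term_comp, Category.comp_id, ← P.term_idMap σ h (𝟙 _), Category.id_comp]
    rw [this, ← Category.assoc, ← Category.assoc]
    congr 1

lemma src_idMap {α : Γ ⟶ U.{w} C} {β : Δ ⟶ U.{w} C} (σ : Δ ⟶ Γ) (h : σ ≫ α = β) :
    P.idMap σ h ≫ P.src α = P.src β ≫ extMap σ h := by
  rw [← Category.assoc, extMap_proj, Category.assoc, Category.assoc]
  exact congr_arg _ (ext₂Map_endVar false σ h)

namespace Introduction

variable {P} (N : P.Introduction)

lemma map_src (α : Γ ⟶ U.{w} C) : N.map α ≫ P.src α = 𝟙 _ := by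
  rw [← Category.assoc, pullback.lift_fst]
  exact diag_endVar false α

/-- The contraction starts at the constant path on the source. -/
lemma endpt_false_contraction (α : Γ ⟶ U.{w} C) :
    endpt J false _ ≫ P.contraction α = P.src α ≫ N.map α := by
  refine hom_ext_term ?_ ?_
  · rw [Category.assoc, contraction_base, lift_snd_assoc, Category.id_comp, Category.assoc,
      map_base, src_proj]
  · rw [term_comp, term_contraction, ← Category.assoc, endpt_whiskerLeft_conn, Category.assoc,
      endpt_term, Category.id_comp, term_comp, term_map, whiskerLeft_snd_assoc, Category.assoc]
    rfl

/-- The contraction is stationary on constant paths. -/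
lemma whiskerLeft_map_contraction (α : Γ ⟶ U.{w} C) :
    J.I ◁ N.map α ≫ P.contraction α = snd _ _ ≫ N.map α := by
  refine hom_ext_term ?_ ?_
  · rw [Category.assoc, contraction_base, whiskerLeft_snd_assoc, Category.assoc]
  · rw [term_comp, term_contraction, term_comp, term_map, ← Category.assoc]
    have h : J.I ◁ J.I ◁ N.map α ≫ CartesianMonoidalCategory.lift
        (CartesianMonoidalCategory.lift (fst _ _) (snd _ _ ≫ fst _ _) ≫ J.conn false)
        (snd _ _ ≫ snd _ _) = CartesianMonoidalCategory.lift
        (CartesianMonoidalCategory.lift (fst _ _) (snd _ _ ≫ fst _ _) ≫ J.conn false)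
        (snd _ _ ≫ snd _ _) ≫ J.I ◁ N.map α := by
      ext1 <;> simp [comp_lift_assoc]
    rw [h, Category.assoc, ← term_comp, Category.comp_id, term_map, lift_snd_assoc,
      whiskerLeft_snd_assoc, Category.assoc]

/-- As the source retracts `N.map`, a path is constant if and only if it equals the constant path on
its source. -/
lemma le_range_map_iff {α : Γ ⟶ U.{w} C} (G : Subfunctor (ext (P.ty α))) :
    G ≤ Subfunctor.range (N.map α) ↔ G.ι ≫ P.src α ≫ N.map α = G.ι := by
  constructor
  · intro h
    have : (Subfunctor.range (N.map α)).ι ≫ P.src α ≫ N.map α =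
        (Subfunctor.range (N.map α)).ι := by
      rw [← cancel_epi (Subfunctor.toRange (N.map α)), ← Category.assoc, Subfunctor.toRange_ι,
        ← Category.assoc, map_src, Category.id_comp]
    rw [← Subfunctor.homOfLe_ι h, Category.assoc, this]
  · intro h c x hx
    exact ⟨(P.src α).app c x, congr_arg (fun f => f.app c ⟨x, hx⟩) h⟩

/-- The locus of constant paths is stable under substitution: a path is determined by its image
under the substitution and its component in the base. -/
lemma preimage_range_map {α : Γ ⟶ U.{w} C} {β : Δ ⟶ U.{w} C} (σ : Δ ⟶ Γ) (h : σ ≫ α = β) :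
    (Subfunctor.range (N.map α)).preimage (P.idMap σ h) = Subfunctor.range (N.map β) := by
  apply le_antisymm
  · have h₁ := Subfunctor.fromPreimage_ι (Subfunctor.range (N.map α)) (P.idMap σ h)
    have h₂ := (N.le_range_map_iff (Subfunctor.range (N.map α))).1 le_rfl
    rw [le_range_map_iff]
    refine hom_ext_term ?_ ?_
    · simp only [Category.assoc, map_base]
      rfl
    · rw [← P.term_idMap σ h, ← P.term_idMap σ h (Subfunctor.ι _)]
      simp only [Category.assoc, N.map_idMap]
      rw [← h₁, ← h₂, ← Category.assoc (Subfunctor.fromPreimage _ _), h₁, Category.assoc,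
        ← Category.assoc (P.idMap σ h), src_idMap]
      simp only [Category.assoc]
  · rintro c _ ⟨x, rfl⟩
    exact ⟨(extMap σ h).app c x, (congr_arg (fun f => f.app c x) (N.map_idMap σ h)).symm⟩

/-- A stable choice of subobjects of the contexts `x y : α, z : α^I(x, y)` consisting of constant
paths, which are cofibrant for the types satisfying `Q`. -/
structure Locus (Q : ∀ {Γ : Psh.{w} C}, (Γ ⟶ U.{w} C) → Prop) where
  φ : ∀ {Γ : Psh.{w} C} (α : Γ ⟶ U.{w} C), Subfunctor (ext (P.ty α))
  cof : ∀ {Γ : Psh.{w} C} (α : Γ ⟶ U.{w} C), Q α → Cof.cof (φ α).ι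
  le_range : ∀ {Γ : Psh.{w} C} (α : Γ ⟶ U.{w} C), φ α ≤ Subfunctor.range (N.map α)
  preimage : ∀ {Γ Δ : Psh.{w} C} {α : Γ ⟶ U.{w} C} {β : Δ ⟶ U.{w} C} (σ : Δ ⟶ Γ) (h : σ ≫ α = β),
    (φ α).preimage (P.idMap σ h) = φ β

/-- The empty locus. -/
def botLocus : N.Locus (fun _ => True) where
  φ _ := ⊥
  cof _ _ := cof_bot _
  le_range _ := bot_le
  preimage _ _ := rfl

/-- The locus of all constant paths. -/
def conLocus : N.Locus (fun α => Cof.cof (N.map α)) where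
  φ α := Subfunctor.range (N.map α)
  cof α hα := by
    have h := (N.le_range_map_iff (Subfunctor.range (N.map α))).1 le_rfl
    have : IsIso ((Subfunctor.range (N.map α)).ι ≫ P.src α) :=
      ⟨Subfunctor.toRange (N.map α), by
        rw [← cancel_mono (Subfunctor.range (N.map α)).ι, Category.assoc, Subfunctor.toRange_ι,
          Category.assoc, h, Category.id_comp], by
        rw [← Category.assoc, Subfunctor.toRange_ι, map_src]⟩
    exact Cof.pullback (IsPullback.of_horiz_isIso
      (⟨by rw [Category.assoc, h, Category.comp_id]⟩ :
        CommSq ((Subfunctor.range (N.map α)).ι ≫ P.src α) _ (N.map α) (𝟙 _))) hα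
  le_range _ := le_rfl
  preimage σ h := N.preimage_range_map σ h

namespace Locus

variable {N} [J.IsTiny] {Q : ∀ {Γ : Psh.{w} C}, (Γ ⟶ U.{w} C) → Prop} (S : N.Locus Q)

/-- The filling problem along the contraction of paths whose solution gives the eliminator: the
element at the start is `b` at the source of the path, and the partial element over the locus is
stationary. -/
def box {α : Γ ⟶ U.{w} C} (hα : Q α) (B : ext (P.ty α) ⟶ Fib J) (b : ext α ⟶ E.{w} C)
    (hb : b ≫ disp.{w} C = N.map α ≫ B ≫ fibTy J) :
    Box J false ((P.contraction α ≫ B) ≫ fibTy J) where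
  φ := S.φ α
  cof := S.cof α hα
  v := snd _ _ ≫ (S.φ α).ι ≫ P.src α ≫ b
  a := P.src α ≫ b
  v_type := by
    have h₀ := (N.le_range_map_iff _).1 (S.le_range α)
    have h : J.I ◁ (S.φ α).ι ≫ P.contraction α =
        snd J.I (S.φ α).toFunctor ≫ (S.φ α).ι ≫ P.src α ≫ N.map α := by
      rw [h₀]
      nth_rw 1 [← h₀]
      rw [← Category.assoc (S.φ α).ι, whiskerLeft_comp, Category.assoc,
        whiskerLeft_map_contraction, whiskerLeft_snd_assoc, Category.assoc, h₀]
    rw [Category.assoc (P.contraction α), ← Category.assoc (J.I ◁ _), h]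
    simp only [Category.assoc, hb]
  a_type := by
    simp only [Category.assoc, hb]
    rw [← Category.assoc (endpt J false _), N.endpt_false_contraction]
    simp only [Category.assoc]
  compat := by rw [lift_snd_assoc, Category.id_comp]

/-- The transport of `b` along the contraction of paths. -/
def transport {α : Γ ⟶ U.{w} C} (hα : Q α) (B : ext (P.ty α) ⟶ Fib J) (b : ext α ⟶ E.{w} C)
    (hb : b ≫ disp.{w} C = N.map α ≫ B ≫ fibTy J) : J.I ⊗ ext (P.ty α) ⟶ E.{w} C :=
  (fibFilling J).boxFill false _ rfl (S.box hα B b hb)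

lemma transport_subst {α : Γ ⟶ U.{w} C} {β : Δ ⟶ U.{w} C} (σ : Δ ⟶ Γ) (h : σ ≫ α = β)
    (hα : Q α) (hβ : Q β) (B : ext (P.ty α) ⟶ Fib J) (b : ext α ⟶ E.{w} C)
    (hb : b ≫ disp.{w} C = N.map α ≫ B ≫ fibTy J)
    (hb' : (extMap σ h ≫ b) ≫ disp.{w} C = N.map β ≫ (P.idMap σ h ≫ B) ≫ fibTy J) :
    S.transport hβ (P.idMap σ h ≫ B) (extMap σ h ≫ b) hb' =
      J.I ◁ P.idMap σ h ≫ S.transport hα B b hb := by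
  have hc : J.I ◁ P.idMap σ h ≫ P.contraction α ≫ B =
      P.contraction β ≫ P.idMap σ h ≫ B := by
    rw [← Category.assoc, contraction_idMap, Category.assoc]
  refine (fibFilling J).boxFill_restrict false _ rfl (S.box hα B b hb) _ hc _ _
    (by rw [← hc, Category.assoc (J.I ◁ _)]) ?_
  refine Box.eq_restrict _ (S.preimage σ h).symm (fun i hi => ?_) ?_
  · change (S.φ β).toFunctor ⟶ (S.φ α).toFunctor at i
    change i ≫ (S.φ α).ι = (S.φ β).ι ≫ P.idMap σ h at hi
    change J.I ◁ i ≫ snd J.I (S.φ α).toFunctor ≫ (S.φ α).ι ≫ P.src α ≫ b =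
      snd J.I (S.φ β).toFunctor ≫ (S.φ β).ι ≫ P.src β ≫ extMap σ h ≫ b
    rw [whiskerLeft_snd_assoc, ← Category.assoc (P.src β), ← src_idMap, ← Category.assoc i, hi]
    simp only [Category.assoc]
  · change P.src β ≫ extMap σ h ≫ b = P.idMap σ h ≫ P.src α ≫ b
    rw [← Category.assoc, ← src_idMap, Category.assoc]

/-- The eliminator obtained from a locus of constant paths. -/
def elimination : N.Elimination (fun A => Q (A ≫ fibTy J)) where
  j _ hA B b hb := endpt J true _ ≫ S.transport hA B b hb
  j_type A hA B b hb := by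
    rw [Category.assoc, transport, Filling.boxFill_type, ← Category.assoc, ← Category.assoc,
      endpt_true_contraction, Category.id_comp]
  j_subst σ A hA hA' B b hb hb' := by
    rw [S.transport_subst σ (Category.assoc σ A (fibTy J)).symm hA hA' B b hb hb',
      ← Category.assoc (endpt J true _), endpt_naturality]
    simp only [Category.assoc]

end Locus

/-- The transport is prescribed to be stationary on the locus of constant paths. -/
lemma computation_conLocus [J.IsTiny] : N.conLocus.elimination.Computation := by
  intro Γ A hA B b hb
  change N.map _ ≫ endpt J true _ ≫ N.conLocus.transport hA B b hb = b
  have h := (fibFilling J).whiskerLeft_ι_boxFill false _ rfl (N.conLocus.box hA B b hb)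
  have h' := congr_arg (fun f => endpt J true _ ≫
    J.I ◁ Subfunctor.toRange (N.map (A ≫ fibTy J)) ≫ f) h
  change endpt J true _ ≫ J.I ◁ _ ≫ J.I ◁ (Subfunctor.range _).ι ≫ _ = endpt J true _ ≫ J.I ◁ _ ≫
    snd _ _ ≫ (Subfunctor.range _).ι ≫ P.src _ ≫ b at h'
  rw [← whiskerLeft_comp_assoc, Subfunctor.toRange_ι, whiskerLeft_snd_assoc, lift_snd_assoc,
    Category.id_comp, ← Category.assoc (Subfunctor.toRange _), Subfunctor.toRange_ι,
    ← Category.assoc, ← Category.assoc (N.map _), map_src, endpt_naturality, Category.id_comp,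
    Category.assoc] at h'
  exact h'

end Introduction

end PathTypes

/-! ### Formation -/

lemma cof_range {X Y : Psh.{w} C} (m : X ⟶ Y) (hm : Cof.cof m) :
    Cof.cof (Subfunctor.range m).ι := by
  have := Cof.mono m hm
  have : Mono (Subfunctor.toRange m ≫ (Subfunctor.range m).ι) := by
    rwa [Subfunctor.toRange_ι]
  have := mono_of_mono (Subfunctor.toRange m) (Subfunctor.range m).ι
  have := isIso_of_mono_of_epi (Subfunctor.toRange m)
  exact Cof.pullback (IsPullback.of_horiz_isIso
    (⟨by rw [Category.comp_id, IsIso.inv_comp_eq, Subfunctor.toRange_ι]⟩ :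
      CommSq (inv (Subfunctor.toRange m)) _ m (𝟙 _))) hm

lemma jointlySurjective_of_app {ι : Type*} {P : ι → Psh.{w} C} {S : Psh.{w} C} (m : ∀ i, P i ⟶ S)
    (h : ∀ (d : Cᵒᵖ) (s : S.obj d), ∃ (i : ι) (p : (P i).obj d), (m i).app d p = s) :
    JointlySurjective m := fun d s => by
  obtain ⟨i, p, hp⟩ := h (op d) (uliftYonedaEquiv s)
  refine ⟨i, uliftYonedaEquiv.symm p, uliftYonedaEquiv.injective ?_⟩
  rw [uliftYonedaEquiv_comp, Equiv.apply_symm_apply, hp]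

variable (J) in
/-- Where the two endpoints of the interval coincide, the interval is trivial. -/
lemma eq_δ_of_δ_eq {W : Psh.{w} C} (h : toUnit W ≫ J.δ false = toUnit W ≫ J.δ true) (i : W ⟶ J.I)
    (k : Bool) : i = toUnit W ≫ J.δ k := by
  have hk : toUnit W ≫ J.δ (!k) = toUnit W ≫ J.δ k := by cases k <;> simp [h]
  have h₁ := i ≫= J.conn_right k
  have h₂ := i ≫= J.conn_right' k
  simp only [comp_lift_assoc, Category.comp_id] at h₁ h₂
  rw [← Category.assoc i, comp_toUnit] at h₁ h₂
  rw [hk] at h₂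
  rw [← h₁, h₂]

variable (J) in
/-- The exchange of the two interval coordinates. -/
def swap (Y : Psh.{w} C) : J.I ⊗ J.I ⊗ Y ⟶ J.I ⊗ J.I ⊗ Y :=
  lift (snd _ _ ≫ fst _ _) (lift (fst _ _) (snd _ _ ≫ snd _ _))

lemma swap_swap (Y : Psh.{w} C) : swap J Y ≫ swap J Y = 𝟙 _ := by
  simp [swap, comp_lift]

lemma swap_snd (Y : Psh.{w} C) : swap J Y ≫ snd _ _ = J.I ◁ snd _ _ := by
  ext1 <;> simp [swap]

lemma swap_whiskerLeft_snd (Y : Psh.{w} C) : swap J Y ≫ J.I ◁ snd _ _ = snd _ _ := by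
  ext1 <;> simp [swap]

lemma swap_naturality {Y Z : Psh.{w} C} (g : Z ⟶ Y) :
    swap J Z ≫ J.I ◁ J.I ◁ g = J.I ◁ J.I ◁ g ≫ swap J Y := by
  simp [swap, comp_lift]

lemma endpt_swap (k : Bool) (Y : Psh.{w} C) : endpt J k _ ≫ swap J Y = J.I ◁ endpt J k Y := by
  ext1 <;> simp [swap, comp_lift]

lemma whiskerLeft_endpt_swap (k : Bool) (Y : Psh.{w} C) :
    J.I ◁ endpt J k Y ≫ swap J Y = endpt J k _ := by
  rw [← endpt_swap, Category.assoc, swap_swap, Category.comp_id]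

section Rim

variable {Y Z : Psh.{w} C} (φ : Subfunctor Y)

variable (J) in
/-- The union of the two ends of the cylinder `I × Y` with the cylinder on a subobject `φ`. -/
def rim : Subfunctor (J.I ⊗ Y) :=
  ((Subfunctor.range (J.δ false)).preimage (fst _ _) ⊔
    (Subfunctor.range (J.δ true)).preimage (fst _ _)) ⊔ φ.preimage (snd _ _)

lemma cof_rim (h : Cof.cof φ.ι) : Cof.cof (rim J φ).ι :=
  Cof.join _ _ (Cof.join _ _ (cof_preimage _ _ (cof_range _ (J.δ_cof _)))
    (cof_preimage _ _ (cof_range _ (J.δ_cof _)))) (cof_preimage _ _ h)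

lemma rim_preimage (g : Z ⟶ Y) : rim J (φ.preimage g) = (rim J φ).preimage (J.I ◁ g) := rfl

/-- The pieces of the rim: its two ends, and the cylinder on `φ`. -/
abbrev rimPiece : Option Bool → Psh.{w} C
  | some _ => Y
  | none => J.I ⊗ φ.toFunctor

variable (J) in
/-- The inclusions of the pieces of the rim. -/
def rimIncl : ∀ b : Option Bool, rimPiece (J := J) φ b ⟶ (rim J φ).toFunctor
  | some b => Subfunctor.lift (endpt J b Y) (by
      rintro c _ ⟨y, rfl⟩
      cases b
      · exact Or.inl (Or.inl ⟨_, rfl⟩)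
      · exact Or.inl (Or.inr ⟨_, rfl⟩))
  | none => Subfunctor.lift (J.I ◁ φ.ι) (by
      rintro c _ ⟨y, rfl⟩
      exact Or.inr y.2.2)

lemma rimIncl_some_ι (b : Bool) : rimIncl J φ (some b) ≫ (rim J φ).ι = endpt J b Y := rfl

lemma rimIncl_none_ι : rimIncl J φ none ≫ (rim J φ).ι = J.I ◁ φ.ι := rfl

lemma jointlySurjective_rimIncl : JointlySurjective (rimIncl J φ) := by
  refine jointlySurjective_of_app _ ?_
  rintro c ⟨⟨i, y⟩, (⟨z, hz⟩ | ⟨z, hz⟩) | hy⟩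
  · exact ⟨some false, y, Subtype.ext (Prod.ext hz rfl)⟩
  · exact ⟨some true, y, Subtype.ext (Prod.ext hz rfl)⟩
  · exact ⟨none, (i, ⟨y, hy⟩), rfl⟩

end Rim

lemma extMap_comp {Γ Δ Θ : Psh.{w} C} {α : Γ ⟶ U.{w} C} {β : Δ ⟶ U.{w} C} {γ : Θ ⟶ U.{w} C}
    (σ : Δ ⟶ Γ) (h : σ ≫ α = β) (τ : Θ ⟶ Δ) (h' : τ ≫ β = γ) :
    extMap τ h' ≫ extMap σ h = extMap (τ ≫ σ) (by rw [Category.assoc, h, h']) := by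
  refine ext_hom_ext ?_ ?_
  · rw [Category.assoc, extMap_proj, ← Category.assoc, extMap_proj, extMap_proj, Category.assoc]
  · rw [Category.assoc, extMap_var, extMap_var, extMap_var]

lemma ext₂Map_comp {Γ Δ Θ : Psh.{w} C} {α : Γ ⟶ U.{w} C} {β : Δ ⟶ U.{w} C} {γ : Θ ⟶ U.{w} C}
    (σ : Δ ⟶ Γ) (h : σ ≫ α = β) (τ : Θ ⟶ Δ) (h' : τ ≫ β = γ) :
    ext₂Map τ h' ≫ ext₂Map σ h = ext₂Map (τ ≫ σ) (by rw [Category.assoc, h, h']) := by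
  rw [extMap_comp]
  congr 1
  simp only [extMap_comp]

namespace PathTypes

variable (P : PathTypes J) {Γ : Psh.{w} C} {α : Γ ⟶ U.{w} C}

section PathBox

variable {k : Bool} {Y Z : Psh.{w} C} (x : J.I ⊗ Y ⟶ ext₂ α) {β : J.I ⊗ Y ⟶ U.{w} C}
  (hx : x ≫ P.ty α = β) (B : Box J k β)

/-- The partial element of a filling problem for the path type, as a map into the extended
context. -/
def partialPath : J.I ⊗ B.φ.toFunctor ⟶ ext (P.ty α) :=
  pair (J.I ◁ B.φ.ι ≫ x) B.v (by rw [B.v_type, Category.assoc, hx])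

/-- The element at the end of the cylinder of a filling problem for the path type, as a map into the
extended context. -/
def endPath : Y ⟶ ext (P.ty α) :=
  pair (endpt J k Y ≫ x) B.a (by rw [B.a_type, Category.assoc, hx])

lemma partialPath_proj : P.partialPath x hx B ≫ proj (P.ty α) = J.I ◁ B.φ.ι ≫ x :=
  pullback.lift_fst _ _ _

lemma partialPath_base : P.partialPath x hx B ≫ P.base α = J.I ◁ B.φ.ι ≫ x ≫ fstVar α ≫ proj α := by
  rw [base, ← Category.assoc, partialPath_proj, Category.assoc]

lemma endPath_proj : P.endPath x hx B ≫ proj (P.ty α) = endpt J k Y ≫ x :=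
  pullback.lift_fst _ _ _

lemma endPath_base : P.endPath x hx B ≫ P.base α = endpt J k Y ≫ x ≫ fstVar α ≫ proj α := by
  rw [base, ← Category.assoc, endPath_proj, Category.assoc]

lemma endpt_partialPath : endpt J k _ ≫ P.partialPath x hx B = B.φ.ι ≫ P.endPath x hx B := by
  refine ext_hom_ext ?_ ?_
  · rw [Category.assoc, Category.assoc, partialPath_proj, endPath_proj, ← Category.assoc,
      endpt_naturality, Category.assoc]
  · rw [Category.assoc, Category.assoc, partialPath, endPath, pullback.lift_snd,
      pullback.lift_snd, B.compat]

/-- The given elements on the pieces of the rim: at the two ends the endpoints of the path, and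
over `φ` the partial family of paths. -/
def rimTerm : ∀ b : Option Bool, J.I ⊗ rimPiece (J := J) B.φ b ⟶ E.{w} C
  | some b => x ≫ endVar b α ≫ var α
  | none => swap J _ ≫ P.term (P.partialPath x hx B)

lemma rimTerm_some_none {W : Psh.{w} C} (b : Bool) (p : W ⟶ Y) (q : W ⟶ J.I ⊗ B.φ.toFunctor)
    (h : p ≫ rimIncl J B.φ (some b) = q ≫ rimIncl J B.φ none) :
    J.I ◁ p ≫ P.rimTerm x hx B (some b) = J.I ◁ q ≫ P.rimTerm x hx B none := by
  have h' := congr_arg (· ≫ (rim J B.φ).ι) h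
  simp only [Category.assoc, rimIncl_some_ι, rimIncl_none_ι] at h'
  have h₁ := congr_arg (· ≫ fst _ _) h'
  have h₂ := congr_arg (· ≫ snd _ _) h'
  simp only [Category.assoc, whiskerLeft_fst, whiskerLeft_snd, lift_fst, lift_snd,
    Category.comp_id, ← Category.assoc p, comp_toUnit] at h₁ h₂
  obtain ⟨s, rfl⟩ : ∃ s : W ⟶ B.φ.toFunctor, q = s ≫ endpt J b _ := by
    refine ⟨q ≫ snd _ _, ?_⟩
    ext1
    · simp [← h₁]
    · simp
  have hp : p = s ≫ B.φ.ι := by simpa using h₂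
  subst hp
  change _ ≫ x ≫ endVar b α ≫ var α = _ ≫ swap J _ ≫ P.term (P.partialPath x hx B)
  rw [whiskerLeft_comp, whiskerLeft_comp, Category.assoc, Category.assoc,
    ← Category.assoc (J.I ◁ endpt J b _), whiskerLeft_endpt_swap, endpt_term,
    ← Category.assoc (P.partialPath x hx B), partialPath_proj, Category.assoc]

/-- At a stage where the endpoints of the interval coincide the cylinder is degenerate, and the
element at its end is a path there from one of the endpoints to the other. -/
lemma rimTerm_some_some {W : Psh.{w} C} (p : W ⟶ Y)
    (h : p ≫ endpt J false Y = p ≫ endpt J true Y) :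
    J.I ◁ p ≫ P.rimTerm x hx B (some false) = J.I ◁ p ≫ P.rimTerm x hx B (some true) := by
  have h₁ := snd J.I W ≫= congr_arg (· ≫ fst _ _) h
  simp only [Category.assoc, lift_fst] at h₁
  simp only [← Category.assoc, comp_toUnit] at h₁
  have hp : J.I ◁ p = snd _ _ ≫ p ≫ endpt J k Y := by
    ext1
    · rw [whiskerLeft_fst, eq_δ_of_δ_eq J h₁ (fst _ _) k]
      simp only [Category.assoc, lift_fst]
      simp only [← Category.assoc, comp_toUnit]
    · simp
  have key : ∀ b, J.I ◁ p ≫ P.rimTerm x hx B (some b) =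
      snd _ _ ≫ (p ≫ endpt J b Y) ≫ P.term (P.endPath x hx B) := fun b => by
    rw [Category.assoc, endpt_term, ← Category.assoc (P.endPath x hx B), endPath_proj, hp]
    simp only [Category.assoc]
    rfl
  rw [key, key, h]

/-- The elements on the pieces of the rim agree on overlaps. -/
lemma exists_rimTerm_glue : ∃ v : J.I ⊗ (rim J B.φ).toFunctor ⟶ E.{w} C,
    ∀ b, J.I ◁ rimIncl J B.φ b ≫ v = P.rimTerm x hx B b := by
  have hsome : ∀ {W : Psh.{w} C} (b b' : Bool) (p q : W ⟶ Y),
      p ≫ rimIncl J B.φ (some b) = q ≫ rimIncl J B.φ (some b') →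
      p = q ∧ p ≫ endpt J b Y = p ≫ endpt J b' Y := fun b b' p q h => by
    have h' := congr_arg (· ≫ (rim J B.φ).ι) h
    simp only [Category.assoc, rimIncl_some_ι] at h'
    have h₂ := congr_arg (· ≫ snd _ _) h'
    simp only [Category.assoc, lift_snd, Category.comp_id] at h₂
    subst h₂
    exact ⟨rfl, h'⟩
  refine (jointlySurjective_rimIncl B.φ).exists_whiskerLeft_glue J.I _ ?_
  rintro d (_ | b) (_ | b') p q h
  · have h' := congr_arg (· ≫ (rim J B.φ).ι) h
    simp only [Category.assoc, rimIncl_none_ι] at h'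
    have h₁ := congr_arg (· ≫ fst _ _) h'
    have h₂ := congr_arg (· ≫ snd _ _) h'
    simp only [Category.assoc, whiskerLeft_fst, whiskerLeft_snd] at h₁ h₂
    rw [← Category.assoc, ← Category.assoc, cancel_mono] at h₂
    obtain rfl : p = q := CartesianMonoidalCategory.hom_ext _ _ h₁ h₂
    rfl
  · exact (P.rimTerm_some_none x hx B b' q p h.symm).symm
  · exact P.rimTerm_some_none x hx B b p q h
  · obtain ⟨rfl, h'⟩ := hsome b b' p q h
    cases b <;> cases b'
    · rfl
    · exact P.rimTerm_some_some x hx B p h'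
    · exact (P.rimTerm_some_some x hx B p h'.symm).symm
    · rfl

/-- The given elements on the whole rim. -/
def rimGlue : J.I ⊗ (rim J B.φ).toFunctor ⟶ E.{w} C := (P.exists_rimTerm_glue x hx B).choose

lemma whiskerLeft_rimIncl_rimGlue (b : Option Bool) :
    J.I ◁ rimIncl J B.φ b ≫ P.rimGlue x hx B = P.rimTerm x hx B b :=
  (P.exists_rimTerm_glue x hx B).choose_spec b

/-- The glued element on the rim is stable under restriction of the filling problem. -/
lemma whiskerLeft_rimGlue {g : Z ⟶ Y} {β' : J.I ⊗ Z ⟶ U.{w} C}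
    (hx' : (J.I ◁ g ≫ x) ≫ P.ty α = β') (B' : Box J k β')
    (j : B'.φ.toFunctor ⟶ B.φ.toFunctor) (hj : j ≫ B.φ.ι = B'.φ.ι ≫ g)
    (hv : J.I ◁ j ≫ B.v = B'.v) (i : (rim J B'.φ).toFunctor ⟶ (rim J B.φ).toFunctor)
    (hi : i ≫ (rim J B.φ).ι = (rim J B'.φ).ι ≫ J.I ◁ g) :
    J.I ◁ i ≫ P.rimGlue x hx B = P.rimGlue _ hx' B' := by
  refine (jointlySurjective_rimIncl _).whiskerLeft_hom_ext J.I fun b => ?_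
  rw [whiskerLeft_rimIncl_rimGlue, ← whiskerLeft_comp_assoc]
  rcases b with _ | b
  · have h : rimIncl J B'.φ none ≫ i = J.I ◁ j ≫ rimIncl J B.φ none := by
      rw [← cancel_mono (rim J B.φ).ι, Category.assoc, hi, Category.assoc, rimIncl_none_ι,
        ← Category.assoc, rimIncl_none_ι, ← whiskerLeft_comp, ← whiskerLeft_comp, hj]
    rw [h, whiskerLeft_comp, Category.assoc, whiskerLeft_rimIncl_rimGlue]
    change _ ≫ swap J _ ≫ P.term _ = swap J _ ≫ P.term _
    rw [← Category.assoc, ← swap_naturality, Category.assoc, ← term_comp]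
    congr 2
    refine ext_hom_ext ?_ ?_
    · rw [partialPath_proj, Category.assoc, partialPath_proj, ← whiskerLeft_comp_assoc, hj,
        whiskerLeft_comp_assoc]
    · rw [Category.assoc, partialPath, partialPath, pullback.lift_snd, pullback.lift_snd, hv]
  · have h : rimIncl J B'.φ (some b) ≫ i = g ≫ rimIncl J B.φ (some b) := by
      rw [← cancel_mono (rim J B.φ).ι, Category.assoc, hi, Category.assoc, rimIncl_some_ι,
        ← Category.assoc, rimIncl_some_ι, endpt_naturality]
    rw [h, whiskerLeft_comp, Category.assoc, whiskerLeft_rimIncl_rimGlue]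
    exact (Category.assoc _ _ _).symm

/-- A filling problem for the path type over `Y` is one for the type itself over the cylinder on
`Y`, whose partial element is given on the rim. -/
def pathBox : Box J k ((J.I ◁ snd J.I Y ≫ x ≫ fstVar α ≫ proj α) ≫ α) where
  φ := rim J B.φ
  cof := cof_rim _ B.cof
  v := P.rimGlue x hx B
  a := P.term (P.endPath x hx B)
  v_type := by
    refine (jointlySurjective_rimIncl B.φ).whiskerLeft_hom_ext J.I fun b => ?_
    rw [← Category.assoc, whiskerLeft_rimIncl_rimGlue, ← whiskerLeft_comp_assoc]
    rcases b with _ | b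
    · change (swap J _ ≫ P.term _) ≫ _ = _
      rw [rimIncl_none_ι, Category.assoc, term_type, ← Category.assoc (P.partialPath x hx B),
        partialPath_base, ← Category.assoc, swap_snd]
      simp only [Category.assoc]
      rw [← whiskerLeft_comp_assoc, ← whiskerLeft_comp_assoc, whiskerLeft_snd]
    · change (x ≫ endVar b α ≫ var α) ≫ _ = _
      rw [rimIncl_some_ι]
      simp only [Category.assoc]
      rw [← proj_comp, ← whiskerLeft_comp_assoc, endpt_snd, whiskerLeft_id, Category.id_comp,
        ← Category.assoc (endVar b α), endVar_proj, Category.assoc]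
  a_type := by
    rw [term_type, ← Category.assoc (P.endPath x hx B), endPath_base]
    simp only [← Category.assoc]
    rw [endpt_naturality]
  compat := by
    refine (jointlySurjective_rimIncl B.φ).hom_ext fun b => ?_
    rw [← Category.assoc, ← endpt_naturality, Category.assoc, whiskerLeft_rimIncl_rimGlue,
      ← Category.assoc]
    rcases b with _ | b
    · change endpt J k _ ≫ swap J _ ≫ P.term _ = _
      rw [rimIncl_none_ι, ← Category.assoc, endpt_swap, ← term_comp, ← term_comp,
        endpt_partialPath]
    · change endpt J k _ ≫ x ≫ endVar b α ≫ var α = _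
      rw [rimIncl_some_ι, endpt_term, ← Category.assoc (P.endPath x hx B), endPath_proj,
        Category.assoc]

variable (F : Filling J α)

/-- The filler for the path type, obtained from the filler for the type. -/
def pathFill : J.I ⊗ Y ⟶ ext (P.ty α) :=
  P.lift (x ≫ fstVar α ≫ proj α) (swap J Y ≫ F.boxFill k _ rfl (P.pathBox x hx B)) (by
    rw [Category.assoc, Filling.boxFill_type]
    simp only [← Category.assoc]
    rw [swap_whiskerLeft_snd])

lemma pathFill_base : P.pathFill x hx B F ≫ P.base α = x ≫ fstVar α ≫ proj α := P.lift_base _ _ _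

lemma term_pathFill : P.term (P.pathFill x hx B F) =
    swap J Y ≫ F.boxFill k _ rfl (P.pathBox x hx B) := P.term_lift _ _ _

lemma whiskerLeft_rimIncl_boxFill (b : Option Bool) :
    J.I ◁ (rimIncl J B.φ b ≫ (rim J B.φ).ι) ≫ F.boxFill k _ rfl (P.pathBox x hx B) =
      P.rimTerm x hx B b := by
  rw [whiskerLeft_comp, Category.assoc, ← whiskerLeft_rimIncl_rimGlue]
  exact congr_arg (_ ≫ ·) (F.whiskerLeft_ι_boxFill k _ rfl (P.pathBox x hx B))

lemma pathFill_proj : P.pathFill x hx B F ≫ proj (P.ty α) = x := by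
  refine ext₂_hom_ext ?_ fun b => ?_
  · exact (Category.assoc _ _ _).trans (P.pathFill_base x hx B F)
  · rw [Category.assoc, ← P.endpt_term b, term_pathFill, ← Category.assoc, endpt_swap,
      ← rimIncl_some_ι B.φ, whiskerLeft_rimIncl_boxFill]
    rfl

lemma endpt_pathFill : endpt J k Y ≫ P.pathFill x hx B F = P.endPath x hx B := by
  refine hom_ext_term ?_ ?_
  · rw [Category.assoc, pathFill_base, endPath_base]
  · rw [term_comp, term_pathFill, ← Category.assoc, whiskerLeft_endpt_swap]
    exact F.endpt_boxFill k _ rfl _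

lemma whiskerLeft_ι_pathFill : J.I ◁ B.φ.ι ≫ P.pathFill x hx B F = P.partialPath x hx B := by
  refine hom_ext_term ?_ ?_
  · rw [Category.assoc, pathFill_base, partialPath_base]
  · rw [term_comp, term_pathFill, ← Category.assoc, ← swap_naturality, Category.assoc,
      ← rimIncl_none_ι, whiskerLeft_rimIncl_boxFill]
    change swap J _ ≫ swap J _ ≫ _ = _
    rw [← Category.assoc, swap_swap, Category.id_comp]

/-- The filler for the path type is uniform. -/
lemma pathFill_restrict (g : Z ⟶ Y) {x' : J.I ⊗ Z ⟶ ext₂ α} (hg : J.I ◁ g ≫ x = x')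
    {β' : J.I ⊗ Z ⟶ U.{w} C} (hx' : x' ≫ P.ty α = β') (hβ : J.I ◁ g ≫ β = β') :
    P.pathFill x' hx' (B.restrict g hβ) F = J.I ◁ g ≫ P.pathFill x hx B F := by
  subst hg
  refine hom_ext_term ?_ ?_
  · simp only [pathFill_base, Category.assoc]
  · rw [term_comp, term_pathFill, term_pathFill, ← Category.assoc (J.I ◁ J.I ◁ g),
      ← swap_naturality, Category.assoc (swap J Z)]
    congr 1
    have hc : J.I ◁ J.I ◁ g ≫ J.I ◁ snd J.I Y ≫ x ≫ fstVar α ≫ proj α =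
        J.I ◁ snd J.I Z ≫ (J.I ◁ g ≫ x) ≫ fstVar α ≫ proj α := by
      rw [← whiskerLeft_comp_assoc, whiskerLeft_snd, whiskerLeft_comp_assoc, Category.assoc]
    refine F.boxFill_restrict k _ rfl _ _ hc _ _ (by
      simpa only [Category.assoc] using congr_arg (· ≫ α) hc) ?_
    refine Box.eq_restrict _ (rim_preimage B.φ g) (fun i hi => ?_) ?_
    · exact P.whiskerLeft_rimGlue x hx B hx' (B.restrict g hβ) (B.φ.fromPreimage g) rfl rfl i hi
    · change P.term _ = J.I ◁ g ≫ P.term _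
      rw [← term_comp]
      congr 1
      refine ext_hom_ext ?_ ?_
      · rw [endPath_proj, Category.assoc, endPath_proj, ← Category.assoc, endpt_naturality,
          Category.assoc]
      · exact (pullback.lift_snd _ _ _).trans (congr_arg (g ≫ ·) (pullback.lift_snd _ _ _).symm)

end PathBox

/-- Path types of a type with a filling operation have a filling operation. -/
def tyFilling (F : Filling J α) : Filling J (P.ty α) where
  fill _ _ x _ hx B := P.pathFill x hx (Box.ofProblem B) F ≫ var (P.ty α)
  fill_type k d x β hx B := by rw [Category.assoc, ← proj_comp, ← Category.assoc, pathFill_proj, hx]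
  fill_endpt k d x β hx B := by
    rw [← Category.assoc, endpt_pathFill]
    exact pullback.lift_snd _ _ _
  fill_partial k d x β hx B := by
    rw [← Category.assoc]
    exact (congr_arg (· ≫ _) (P.whiskerLeft_ι_pathFill x hx (Box.ofProblem B) F)).trans
      (pullback.lift_snd _ _ _)
  uniform k d e x β hx B g x' β' hx' hβ hg := by
    rw [← Category.assoc, ← P.pathFill_restrict x hx (Box.ofProblem B) F _ hg hx' hβ]
    rfl

/-- Substitution along `A : Γ ⟶ Fib` reduces formation to the generic fibrant type. -/
lemma exists_formation [J.IsTiny] : Nonempty P.Formation := by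
  obtain ⟨T, hT⟩ := (P.tyFilling (fibFilling J)).exists_fib
  refine ⟨fun A => ext₂Map A rfl ≫ T, fun A => ?_, fun {Γ Δ} A σ => ?_⟩
  · rw [Category.assoc, hT, P.ty_subst]
  · rw [← Category.assoc, ext₂Map_comp]

end PathTypes

/-! ### The universe classifies maps with small fibres -/

section Pointed

variable {D : Type*} [Category D]

/-- The functor to pointed types determined by a functor to types and a compatible family of
points. Every functor to pointed types is definitionally of this form. -/
def pointedOfSection (G : D ⥤ Type w) (s : G.sections) : D ⥤ Pointed.{w} where
  obj X := ⟨G.obj X, s.1 X⟩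
  map f := ⟨G.map f, s.2 f⟩
  map_id X := Pointed.Hom.ext (by funext x; exact congr($(G.map_id X) x))
  map_comp f g := Pointed.Hom.ext (by funext x; exact congr($(G.map_comp f g) x))

/-- The family of points of a functor to pointed types. -/
def pointSection (F : D ⥤ Pointed.{w}) : (F ⋙ forget Pointed.{w}).sections :=
  ⟨fun X => (F.obj X).point, fun f => (F.map f).map_point⟩

end Pointed

/-- As the slice has a terminal object, sections are determined by their value there. -/
lemma sections_over_ext {c : C} {G : (Over c)ᵒᵖ ⥤ Type w} {s t : G.sections}
    (h : s.1 (op (Over.mk (𝟙 c))) = t.1 (op (Over.mk (𝟙 c)))) : s = t := by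
  refine Subtype.ext (funext fun X => ?_)
  rw [← s.2 (Over.homMk X.unop.hom (by simp) : X.unop ⟶ Over.mk (𝟙 c)).op, h, t.2]

/-- The family of points of an element of `E` over a given element of `U`. -/
def dispSection {c : Cᵒᵖ} {G : (U.{w} C).obj c} (e : (E.{w} C).obj c)
    (h : (disp.{w} C).app c e = G) : Functor.sections G :=
  h ▸ pointSection e

lemma pointedOfSection_dispSection {c : Cᵒᵖ} {G : (U.{w} C).obj c} (e : (E.{w} C).obj c)
    (h : (disp.{w} C).app c e = G) : pointedOfSection G (dispSection e h) = e := by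
  subst h
  rfl

/-- The fibres of `disp` are small. -/
lemma small_disp_fiber {c : Cᵒᵖ} (G : (U.{w} C).obj c) :
    Small.{w} {e : (E.{w} C).obj c // (disp.{w} C).app c e = G} := by
  refine small_of_injective (β := G.obj (op (Over.mk (𝟙 c.unop))))
    (f := fun e => (dispSection e.1 e.2).1 _) fun e e' h => Subtype.ext ?_
  rw [← pointedOfSection_dispSection e.1 e.2, ← pointedOfSection_dispSection e'.1 e'.2,
    sections_over_ext h]

/-- A compatible family of elements of `Y` over the slice `C/c`. -/
@[ext]
structure SliceElem (Y : Psh.{w} C) (c : C) where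
  val : ∀ g : Over c, Y.obj (op g.left)
  map_val : ∀ {g g' : Over c} (h : g' ⟶ g), Y.map h.left.op (val g) = val g'

namespace SliceElem

variable {X Y : Psh.{w} C} {c d : C}

/-- The restrictions of an element of a presheaf to the slice. -/
def restrictions {c : Cᵒᵖ} (y : Y.obj c) : SliceElem Y c.unop where
  val g := Y.map g.hom.op y
  map_val h := by
    rw [← Functor.map_comp_apply, ← op_comp, Over.w]

/-- Pullback of a compatible family along a map of the base. -/
def comap (t : SliceElem Y c) (h : d ⟶ c) : SliceElem Y d where
  val g := t.val ((Over.map h).obj g)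
  map_val k := t.map_val ((Over.map h).map k)

/-- The image of a compatible family. -/
def image (f : Y ⟶ X) (t : SliceElem Y c) : SliceElem X c where
  val g := f.app _ (t.val g)
  map_val h := by rw [← NatTrans.naturality_apply, t.map_val]

lemma restrictions_map {c d : Cᵒᵖ} (h : c ⟶ d) (y : Y.obj c) :
    restrictions (Y.map h y) = (restrictions y).comap h.unop := by
  ext g
  change Y.map _ (Y.map _ y) = Y.map _ y
  rw [← Functor.map_comp_apply]
  rfl

lemma restrictions_app (f : Y ⟶ X) {c : Cᵒᵖ} (y : Y.obj c) :
    restrictions (f.app c y) = (restrictions y).image f := by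
  ext g
  exact (NatTrans.naturality_apply f _ y).symm

lemma restrictions_val_id (y : Y.obj (op c)) : (restrictions y).val (Over.mk (𝟙 c)) = y :=
  ConcreteCategory.congr_hom (Y.map_id (op c)) y

end SliceElem

open SliceElem

section Classifier

variable {X Y : Psh.{w} C} (f : Y ⟶ X)
  [∀ (c : Cᵒᵖ) (x : X.obj c), Small.{w} {y : Y.obj c // f.app c y = x}]

/-- The presheaf of fibres, shrunk to small sets, of a map over a compatible family of elements. -/
def fiberFunctor {c : C} (s : SliceElem X c) : (Over c)ᵒᵖ ⥤ Type w where
  obj g := Shrink.{w} {y : Y.obj (op g.unop.left) // f.app _ y = s.val g.unop}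
  map {g g'} h := ↾ fun z => equivShrink _ ⟨Y.map h.unop.left.op ((equivShrink _).symm z).1, by
    rw [NatTrans.naturality_apply, ((equivShrink _).symm z).2]
    exact s.map_val h.unop⟩
  map_id g := by
    ext z
    simp
  map_comp h h' := by
    ext z
    simp

/-- A compatible family of elements of the domain, as a family of points of the fibres. -/
def fiberPoint {c : C} (t : SliceElem Y c) : (fiberFunctor f (t.image f)).sections :=
  ⟨fun g => equivShrink _ ⟨t.val g.unop, rfl⟩, fun {g g'} k => by
    change equivShrink _ _ = equivShrink _ _
    congr 1
    exact Subtype.ext ((congr_arg (Y.map k.unop.left.op)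
      (congr_arg Subtype.val (Equiv.symm_apply_apply _ _))).trans (t.map_val k.unop))⟩

/-- A pointing of the fibres is given by the family of elements `t` if its point in the fibre over the
terminal object of the slice is given by the member of `t` there. -/
lemma eq_pointedOfSection {c : C} (t : SliceElem Y c) (s : SliceElem X c) (h : t.image f = s)
    (σ : (fiberFunctor f s).sections)
    (hσ : ((equivShrink _).symm (σ.1 (op (Over.mk (𝟙 c))))).1 = t.val (Over.mk (𝟙 c))) :
    pointedOfSection _ (fiberPoint f t) = pointedOfSection _ σ := by
  subst h
  congr 1
  refine sections_over_ext ((equivShrink _).symm.injective (Subtype.ext ?_))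
  rw [hσ]
  exact congr_arg Subtype.val (Equiv.symm_apply_apply _ _)

/-- The map to the universe classifying a map with small fibres. -/
def classifier : X ⟶ U.{w} C where
  app c := ↾ fun x => fiberFunctor f (restrictions x)
  naturality c d h := by
    ext x
    change fiberFunctor f (restrictions (X.map h x)) =
      (Over.map h.unop).op ⋙ fiberFunctor f (restrictions x)
    rw [restrictions_map]
    rfl

/-- The generic element of the fibres of a map with small fibres. -/
def classifierElem : Y ⟶ E.{w} C where
  app c := ↾ fun y => pointedOfSection _ (fiberPoint f (restrictions y))
  naturality c d h := by
    ext y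
    change pointedOfSection _ (fiberPoint f (restrictions (Y.map h y))) =
      (Over.map h.unop).op ⋙ pointedOfSection _ (fiberPoint f (restrictions y))
    rw [restrictions_map]
    rfl

/-- Every map with small fibres is a pullback of `disp`. -/
lemma isPullback_classifier : IsPullback f (classifierElem f) (classifier f) (disp.{w} C) := by
  refine IsPullback.of_forall_isPullback_app fun ⟨c⟩ => ?_
  rw [Types.isPullback_iff]
  refine ⟨?_, ?_, ?_⟩
  · ext y
    change fiberFunctor f (restrictions (f.app _ y)) = fiberFunctor f ((restrictions y).image f)
    rw [restrictions_app]
  · rintro y y' ⟨h, h'⟩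
    -- the element is recovered from the point in the fibre over the terminal object of the slice
    have key : ∀ (t : SliceElem Y c) (s : SliceElem X c) (_ : t.image f = s)
        (e : (E.{w} C).obj (op c)) (_ : e = pointedOfSection _ (fiberPoint f t))
        (h : (disp.{w} C).app (op c) e = fiberFunctor f s),
        ((equivShrink _).symm ((dispSection (G := fiberFunctor f s) e h).1
          (op (Over.mk (𝟙 c))))).1 = t.val (Over.mk (𝟙 c)) := by
      rintro t _ rfl _ rfl h
      exact congr_arg Subtype.val (Equiv.symm_apply_apply _ _)
    have h₀ := (restrictions_app f y).symm
    have h₁ := key (restrictions y) _ h₀ ((classifierElem f).app (op c) y) rfl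
      (congr_arg (fiberFunctor f) h₀)
    have h₂ := key (restrictions y') (restrictions (f.app (op c) y))
      (by rw [h]; exact (restrictions_app f y').symm) _ h' (congr_arg (fiberFunctor f) h₀)
    exact (restrictions_val_id y).symm.trans (h₁.symm.trans (h₂.trans (restrictions_val_id y')))
  · intro x e h
    let σ := dispSection (G := fiberFunctor f (restrictions x)) e h.symm
    let z := (equivShrink _).symm (σ.1 (op (Over.mk (𝟙 c))))
    have hz : f.app (op c) z.1 = x := z.2.trans (restrictions_val_id x)
    refine ⟨z.1, hz, ?_⟩
    rw [← pointedOfSection_dispSection (G := fiberFunctor f (restrictions x)) e h.symm]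
    refine eq_pointedOfSection f (restrictions (Y := Y) (c := op c) z.1) _ ?_ σ ?_
    · exact (restrictions_app f _).symm.trans (congr_arg _ hz)
    · exact (restrictions_val_id _).symm

end Classifier

/-! ### The cylinder on a representable is a retract of a representable -/

/-- As the path functor preserves colimits, the identity of the cylinder on `y c` factors through one
of the representables of which the cylinder is a colimit. -/
lemma exists_retract [J.IsTiny] (c : C) :
    ∃ (d : C) (r : yo.{w}.obj d ⟶ J.I ⊗ yo.{w}.obj c) (s : J.I ⊗ yo.{w}.obj c ⟶ yo.{w}.obj d),
      s ≫ r = 𝟙 _ := by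
  let X := J.I ⊗ yo.{w}.obj c
  have hX := Presheaf.isColimitTautologicalCocone'.{max (w + 1) u} X
  have h₁ := isColimitOfPreserves (path J ⋙ (evaluation _ _).obj (op c)) hX
  obtain ⟨g, y, hy⟩ := Types.jointly_surjective_of_isColimit h₁
    (uliftYonedaEquiv (MonoidalClosed.curry (𝟙 X)))
  refine ⟨g.left, g.hom, MonoidalClosed.uncurry (uliftYonedaEquiv.symm y), ?_⟩
  rw [← MonoidalClosed.uncurry_natural_right]
  apply MonoidalClosed.curry_injective
  apply uliftYonedaEquiv.injective
  rw [MonoidalClosed.curry_uncurry, uliftYonedaEquiv_comp]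
  exact (congr_arg _ (Equiv.apply_symm_apply _ _)).trans hy

/-- Restriction along the retraction from a representable is injective on elements over the cylinder,
so smallness follows from that of the fibres of `disp`. -/
lemma small_cylinder_fiber [J.IsTiny] {c : C} (v : J.I ⊗ yo.{w}.obj c ⟶ U.{w} C) :
    Small.{w} {p : J.I ⊗ yo.{w}.obj c ⟶ E.{w} C // p ≫ disp.{w} C = v} := by
  obtain ⟨d, r, s, hs⟩ := exists_retract (J := J) c
  have := small_disp_fiber (uliftYonedaEquiv (r ≫ v))
  refine small_of_injective (β := {e : (E.{w} C).obj (op d) //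
    (disp.{w} C).app (op d) e = uliftYonedaEquiv (r ≫ v)})
    (f := fun p => ⟨uliftYonedaEquiv (r ≫ p.1), by
      rw [← uliftYonedaEquiv_comp, Category.assoc, p.2]⟩) fun p q h => Subtype.ext ?_
  have h' := uliftYonedaEquiv.injective (congr_arg Subtype.val h)
  rw [← Category.id_comp p.1, ← hs, Category.assoc, h', ← Category.assoc, hs, Category.id_comp]

/-! ### Existence of path types -/

section Vertical

variable {Z W : Psh.{w} C}

variable (J) in
/-- The object of vertical paths in `E`: paths in the fibres of `disp`. -/
abbrev VertPath : Psh.{w} C := pullback ((path J).map (disp.{w} C)) (const J (U.{w} C))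

variable (J) in
/-- The type in which a vertical path runs. -/
abbrev vertBase : VertPath J ⟶ U.{w} C :=
  pullback.snd ((path J).map (disp.{w} C)) (const J (U.{w} C))

variable (J) in
/-- Evaluation of vertical paths. -/
def vertTerm : J.I ⊗ VertPath J ⟶ E.{w} C := MonoidalClosed.uncurry (pullback.fst _ _)

lemma vertTerm_disp : vertTerm J ≫ disp.{w} C = snd _ _ ≫ vertBase J := by
  rw [vertTerm, ← MonoidalClosed.uncurry_natural_right, pullback.condition,
    MonoidalClosed.uncurry_natural_left, uncurry_const, whiskerLeft_snd]

lemma vertPath_hom_ext {s t : Z ⟶ VertPath J} (h : s ≫ vertBase J = t ≫ vertBase J)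
    (h' : J.I ◁ s ≫ vertTerm J = J.I ◁ t ≫ vertTerm J) : s = t := by
  refine pullback.hom_ext (MonoidalClosed.uncurry_injective ?_) h
  rw [MonoidalClosed.uncurry_natural_left, MonoidalClosed.uncurry_natural_left]
  exact h'

/-- Families of vertical paths are classified by `VertPath`. -/
lemma exists_vertPath (γ : Z ⟶ U.{w} C) (p : J.I ⊗ Z ⟶ E.{w} C)
    (h : p ≫ disp.{w} C = snd _ _ ≫ γ) :
    ∃ t : Z ⟶ VertPath J, t ≫ vertBase J = γ ∧ J.I ◁ t ≫ vertTerm J = p := by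
  refine ⟨pullback.lift (MonoidalClosed.curry p) γ ?_, pullback.lift_snd _ _ _, ?_⟩
  · rw [← MonoidalClosed.curry_natural_right, h, ← whiskerLeft_snd,
      MonoidalClosed.curry_natural_left]
  · rw [vertTerm, ← MonoidalClosed.uncurry_natural_left, pullback.lift_fst,
      MonoidalClosed.uncurry_curry]

lemma endpt_vertTerm_disp (k : Bool) :
    (endpt J k _ ≫ vertTerm J) ≫ disp.{w} C = vertBase J := by
  rw [Category.assoc, vertTerm_disp, ← Category.assoc, endpt_snd, Category.id_comp]

/-- A family of pairs of elements of a type. -/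
def pair₂ {Γ : Psh.{w} C} {α : Γ ⟶ U.{w} C} (γ : Z ⟶ Γ) (e : Bool → (Z ⟶ E.{w} C))
    (h : ∀ k, e k ≫ disp.{w} C = γ ≫ α) : Z ⟶ ext₂ α :=
  pair (pair γ (e false) (h false)) (e true) (by
    rw [h, ← Category.assoc, pullback.lift_fst])

section

variable {Γ : Psh.{w} C} {α : Γ ⟶ U.{w} C} (γ : Z ⟶ Γ) (e : Bool → (Z ⟶ E.{w} C))
  (h : ∀ k, e k ≫ disp.{w} C = γ ≫ α)

lemma pair₂_base : pair₂ γ e h ≫ fstVar α ≫ proj α = γ := by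
  rw [← Category.assoc, pair₂, pullback.lift_fst, pullback.lift_fst]

lemma pair₂_endVar (k : Bool) : pair₂ γ e h ≫ endVar k α ≫ var α = e k := by
  cases k
  · change pair₂ γ e h ≫ fstVar α ≫ var α = _
    rw [← Category.assoc, pair₂, pullback.lift_fst, pullback.lift_snd]
  · change pair₂ γ e h ≫ sndVar α ≫ var α = _
    rw [sndVar_var, pair₂, pullback.lift_snd]

end

variable (J) in
/-- The endpoints of vertical paths. -/
def vertEnds : VertPath J ⟶ ext₂ (𝟙 (U.{w} C)) :=
  pair₂ (vertBase J) (fun k => endpt J k _ ≫ vertTerm J)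
    (fun k => by rw [endpt_vertTerm_disp, Category.comp_id])

lemma vertEnds_base : vertEnds J ≫ fstVar _ ≫ proj _ = vertBase J := pair₂_base _ _ _

lemma vertEnds_endVar (k : Bool) : vertEnds J ≫ endVar k _ ≫ var _ = endpt J k _ ≫ vertTerm J :=
  pair₂_endVar _ _ _ _

/-- There is only a small set of vertical paths with given endpoints. -/
lemma small_vertEnds_fiber [J.IsTiny] (c : Cᵒᵖ) (x : (ext₂ (𝟙 (U.{w} C))).obj c) :
    Small.{w} {y : (VertPath J).obj c // (vertEnds J).app c y = x} := by
  let v : yo.{w}.obj c.unop ⟶ U.{w} C :=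
    uliftYonedaEquiv.symm x ≫ fstVar (𝟙 (U.{w} C)) ≫ proj (𝟙 (U.{w} C))
  have hv : ∀ y : {y : (VertPath J).obj c // (vertEnds J).app c y = x},
      uliftYonedaEquiv.symm y.1 ≫ vertBase J = v := by
    rintro ⟨y, rfl⟩
    rw [← vertEnds_base, ← Category.assoc]
    exact congr_arg (· ≫ fstVar (𝟙 (U.{w} C)) ≫ proj (𝟙 (U.{w} C)))
      (uliftYonedaEquiv_symm_comp y (vertEnds J))
  have := small_cylinder_fiber (J := J) (snd J.I _ ≫ v)
  refine small_of_injective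
    (β := {p : J.I ⊗ yo.{w}.obj c.unop ⟶ E.{w} C // p ≫ disp.{w} C = snd _ _ ≫ v})
    (f := fun y => ⟨J.I ◁ uliftYonedaEquiv.symm y.1 ≫ vertTerm J, by
      rw [Category.assoc, vertTerm_disp, whiskerLeft_snd_assoc, hv]⟩)
    fun y y' h => Subtype.ext (uliftYonedaEquiv.{max (w + 1) u}.symm.injective ?_)
  exact vertPath_hom_ext ((hv y).trans (hv y').symm) (congr_arg Subtype.val h)

end Vertical

section PathTypes

variable [J.IsTiny] {Γ Δ Z : Psh.{w} C}

attribute [local instance] small_vertEnds_fiber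

variable (J) in
/-- The path type of a type, restricted from the one classifying vertical paths in `E`. -/
def pathTy (α : Γ ⟶ U.{w} C) : ext₂ α ⟶ U.{w} C :=
  ext₂Map α (Category.comp_id α) ≫ classifier (vertEnds J)

/-- The vertical path underlying an element of a path type. -/
def toVertPath (α : Γ ⟶ U.{w} C) : ext (pathTy J α) ⟶ VertPath J :=
  (isPullback_classifier (vertEnds J)).lift (proj _ ≫ ext₂Map α (Category.comp_id α)) (var _) (by
    rw [Category.assoc, ← proj_comp]
    rfl)

lemma toVertPath_ends (α : Γ ⟶ U.{w} C) :
    toVertPath α ≫ vertEnds J = proj _ ≫ ext₂Map α (Category.comp_id α) :=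
  (isPullback_classifier (vertEnds J)).lift_fst _ _ _

lemma toVertPath_elem (α : Γ ⟶ U.{w} C) :
    toVertPath α ≫ classifierElem (vertEnds J) = var (pathTy J α) :=
  (isPullback_classifier (vertEnds J)).lift_snd _ _ _

lemma toVertPath_base (α : Γ ⟶ U.{w} C) :
    toVertPath α ≫ vertBase J = proj (pathTy J α) ≫ fstVar α ≫ proj α ≫ α := by
  have h : ext₂Map α (Category.comp_id α) ≫ fstVar _ = fstVar α ≫ extMap α (Category.comp_id α) :=
    extMap_proj _ _
  rw [← vertEnds_base, ← Category.assoc, toVertPath_ends, Category.assoc, ← Category.assoc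
    (ext₂Map α _), h, Category.assoc, extMap_proj]

/-- The family of elements underlying an element of a path type. -/
def pathTerm (α : Γ ⟶ U.{w} C) : J.I ⊗ ext (pathTy J α) ⟶ E.{w} C :=
  J.I ◁ toVertPath α ≫ vertTerm J

lemma pathTerm_disp (α : Γ ⟶ U.{w} C) :
    pathTerm α ≫ disp.{w} C = (snd _ _ ≫ proj (pathTy J α) ≫ fstVar α ≫ proj α) ≫ α := by
  rw [pathTerm, Category.assoc, vertTerm_disp, whiskerLeft_snd_assoc, toVertPath_base]
  simp only [Category.assoc]

lemma endpt_pathTerm (k : Bool) (α : Γ ⟶ U.{w} C) :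
    endpt J k _ ≫ pathTerm α = proj (pathTy J α) ≫ endVar k α ≫ var α := by
  rw [pathTerm, ← Category.assoc, endpt_naturality, Category.assoc, ← vertEnds_endVar,
    ← Category.assoc, toVertPath_ends, Category.assoc, ← Category.assoc (ext₂Map α _),
    ext₂Map_endVar, Category.assoc, extMap_var]

lemma pathTy_hom_ext {α : Γ ⟶ U.{w} C} {s t : Z ⟶ ext (pathTy J α)}
    (h : s ≫ proj (pathTy J α) ≫ fstVar α ≫ proj α = t ≫ proj (pathTy J α) ≫ fstVar α ≫ proj α)
    (h' : J.I ◁ s ≫ pathTerm α = J.I ◁ t ≫ pathTerm α) : s = t := by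
  refine ext_hom_ext (ext₂_hom_ext (by simpa only [Category.assoc] using h) fun k => ?_) ?_
  · rw [Category.assoc, Category.assoc, ← endpt_pathTerm, ← Category.assoc, ← Category.assoc,
      ← endpt_naturality, ← endpt_naturality, Category.assoc, Category.assoc, h']
  · rw [← toVertPath_elem, ← Category.assoc, ← Category.assoc]
    congr 1
    refine vertPath_hom_ext ?_ ?_
    · have := congr_arg (· ≫ α) h
      simpa only [Category.assoc, toVertPath_base] using this
    · simpa only [pathTerm, whiskerLeft_comp, Category.assoc] using h'

/-- A vertical path in `α` over `γ` determines an element of the path type. -/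
lemma exists_pathTy_lift {α : Γ ⟶ U.{w} C} (γ : Z ⟶ Γ) (p : J.I ⊗ Z ⟶ E.{w} C)
    (h : p ≫ disp.{w} C = snd _ _ ≫ γ ≫ α) :
    ∃ t : Z ⟶ ext (pathTy J α), t ≫ proj (pathTy J α) ≫ fstVar α ≫ proj α = γ ∧
      J.I ◁ t ≫ pathTerm α = p := by
  obtain ⟨u, hu, rfl⟩ := exists_vertPath (γ ≫ α) p h
  have hk : ∀ k, (endpt J k Z ≫ J.I ◁ u ≫ vertTerm J) ≫ disp.{w} C = γ ≫ α := fun k => by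
    rw [Category.assoc, h, ← Category.assoc, endpt_snd, Category.id_comp]
  let x : Z ⟶ ext₂ α := pair₂ γ (fun k => endpt J k Z ≫ J.I ◁ u ≫ vertTerm J) hk
  have hx : x ≫ ext₂Map α (Category.comp_id α) = u ≫ vertEnds J := by
    refine ext₂_hom_ext ?_ fun k => ?_
    · have h₁ : ext₂Map α (Category.comp_id α) ≫ fstVar _ =
          fstVar α ≫ extMap α (Category.comp_id α) := extMap_proj _ _
      rw [Category.assoc, Category.assoc, vertEnds_base, hu, ← Category.assoc (ext₂Map α _), h₁,
        Category.assoc, extMap_proj, ← Category.assoc (fstVar α), ← Category.assoc x, pair₂_base]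
    · rw [Category.assoc, Category.assoc, vertEnds_endVar, ← Category.assoc (ext₂Map α _),
        ext₂Map_endVar, Category.assoc, extMap_var, pair₂_endVar, ← Category.assoc,
        endpt_naturality, Category.assoc]
  have ht : (u ≫ classifierElem (vertEnds J)) ≫ disp.{w} C = x ≫ pathTy J α := by
    rw [Category.assoc, ← (isPullback_classifier (vertEnds J)).w, ← Category.assoc, ← hx,
      Category.assoc]
    rfl
  let t : Z ⟶ ext (pathTy J α) := pair x (u ≫ classifierElem (vertEnds J)) ht
  have htx : t ≫ proj (pathTy J α) = x := pullback.lift_fst _ _ _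
  have htu : t ≫ toVertPath α = u := by
    refine (isPullback_classifier (vertEnds J)).hom_ext ?_ ?_
    · rw [Category.assoc, toVertPath_ends, ← Category.assoc, htx, hx]
    · rw [Category.assoc, toVertPath_elem]
      exact pullback.lift_snd _ _ _
  refine ⟨t, ?_, ?_⟩
  · rw [← Category.assoc, htx]
    exact pair₂_base _ _ _
  · rw [pathTerm, ← whiskerLeft_comp_assoc, htu]

/-- The path in the extended context underlying an element of a path type. -/
def pathTyPaths (α : Γ ⟶ U.{w} C) : ext (pathTy J α) ⟶ (path J).obj (ext α) :=
  MonoidalClosed.curry (pair (snd _ _ ≫ proj (pathTy J α) ≫ fstVar α ≫ proj α) (pathTerm α)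
    (pathTerm_disp α))

lemma pathTyPaths_evAt (k : Bool) (α : Γ ⟶ U.{w} C) :
    pathTyPaths α ≫ evAt J k (ext α) = proj (pathTy J α) ≫ endVar k α := by
  rw [← Category.assoc, ← endpt_naturality, Category.assoc, ← MonoidalClosed.uncurry_eq,
    pathTyPaths, MonoidalClosed.uncurry_curry]
  refine ext_hom_ext ?_ ?_
  · rw [Category.assoc, pullback.lift_fst, ← Category.assoc, endpt_snd, Category.id_comp,
      Category.assoc, endVar_proj]
  · rw [Category.assoc, pullback.lift_snd, endpt_pathTerm, Category.assoc]

lemma isPullback_pathTyPaths (α : Γ ⟶ U.{w} C) :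
    IsPullback (pathTyPaths α) (proj (pathTy J α) ≫ fstVar α ≫ proj α) ((path J).map (proj α))
      (const J Γ) := by
  have huncurry : ∀ {Z : Psh.{w} C} (t : Z ⟶ ext (pathTy J α)),
      MonoidalClosed.uncurry (t ≫ pathTyPaths α) ≫ var α = J.I ◁ t ≫ pathTerm α := fun t => by
    rw [MonoidalClosed.uncurry_natural_left, pathTyPaths, MonoidalClosed.uncurry_curry,
      Category.assoc, pullback.lift_snd]
  have hw : pathTyPaths α ≫ (path J).map (proj α) =
      (proj (pathTy J α) ≫ fstVar α ≫ proj α) ≫ const J Γ := by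
    apply MonoidalClosed.uncurry_injective
    rw [MonoidalClosed.uncurry_natural_right, MonoidalClosed.uncurry_natural_left, uncurry_const,
      whiskerLeft_snd, pathTyPaths, MonoidalClosed.uncurry_curry, pullback.lift_fst]
  have hp : ∀ s : PullbackCone ((path J).map (proj α)) (const J Γ),
      MonoidalClosed.uncurry s.fst ≫ proj α = snd _ _ ≫ s.snd := fun s => by
    rw [← MonoidalClosed.uncurry_natural_right, s.condition, MonoidalClosed.uncurry_natural_left,
      uncurry_const, whiskerLeft_snd]
  have hs : ∀ s : PullbackCone ((path J).map (proj α)) (const J Γ),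
      ∃ t : s.pt ⟶ ext (pathTy J α), t ≫ proj (pathTy J α) ≫ fstVar α ≫ proj α = s.snd ∧
        J.I ◁ t ≫ pathTerm α = MonoidalClosed.uncurry s.fst ≫ var α := fun s =>
    exists_pathTy_lift _ _ (by rw [Category.assoc, ← proj_comp, ← Category.assoc, hp,
      Category.assoc])
  choose t ht₁ ht₂ using hs
  refine ⟨⟨hw⟩, ⟨PullbackCone.IsLimit.mk _ t (fun s => ?_) ht₁ fun s m h₁ h₂ => ?_⟩⟩
  · refine MonoidalClosed.uncurry_injective (ext_hom_ext ?_ ?_)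
    · rw [hp, ← MonoidalClosed.uncurry_natural_right, Category.assoc, hw, ← Category.assoc, ht₁,
        MonoidalClosed.uncurry_natural_left, uncurry_const, whiskerLeft_snd]
    · rw [huncurry, ht₂]
  · exact pathTy_hom_ext (h₂.trans (ht₁ s).symm) (by rw [ht₂, ← huncurry, h₁])

variable (J) in
/-- Path types exist, and are strictly stable since they are all restricted from one classifier. -/
lemma exists_pathTypes : Nonempty (PathTypes J) := by
  have hsub : ∀ {Γ Δ : Psh.{w} C} {α : Γ ⟶ U.{w} C} {β : Δ ⟶ U.{w} C} (σ : Δ ⟶ Γ) (h : σ ≫ α = β),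
      ext₂Map σ h ≫ pathTy J α = pathTy J β := by
    intro Γ Δ α β σ h
    subst h
    rw [pathTy, ← Category.assoc, ext₂Map_comp]
    rfl
  refine ⟨pathTy J, pathTyPaths, isPullback_pathTyPaths, pathTyPaths_evAt false,
    pathTyPaths_evAt true, hsub, fun {Γ Δ α β} σ h => ?_⟩
  have hfst : ext₂Map σ h ≫ fstVar α = fstVar β ≫ extMap σ h := extMap_proj _ _
  have hvert : extMap (ext₂Map σ h) (hsub σ h) ≫ toVertPath α = toVertPath β := by
    refine (isPullback_classifier (vertEnds J)).hom_ext ?_ ?_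
    · rw [Category.assoc, toVertPath_ends, toVertPath_ends, ← Category.assoc, extMap_proj,
        Category.assoc, ext₂Map_comp]
      subst h
      rfl
    · rw [Category.assoc, toVertPath_elem, toVertPath_elem, extMap_var]
  apply MonoidalClosed.uncurry_injective
  rw [MonoidalClosed.uncurry_natural_left, MonoidalClosed.uncurry_natural_right, pathTyPaths,
    pathTyPaths, MonoidalClosed.uncurry_curry, MonoidalClosed.uncurry_curry]
  refine ext_hom_ext ?_ ?_
  · rw [Category.assoc, pullback.lift_fst, Category.assoc, extMap_proj, ← Category.assoc
      (pullback.lift _ _ _), pullback.lift_fst, whiskerLeft_snd_assoc, ← Category.assoc (extMap _ _),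
      extMap_proj, Category.assoc, ← Category.assoc (ext₂Map σ h), hfst]
    simp only [Category.assoc, extMap_proj]
  · rw [Category.assoc, pullback.lift_snd, Category.assoc, extMap_var, pullback.lift_snd, pathTerm,
      pathTerm, ← whiskerLeft_comp_assoc, hvert]

end PathTypes

end PshTT

end

open PshTT in
theorem mainTheorem12 {C : Type u} [Category.{v} C] (Cof : CofibrationClass.{w} C)
    (J : Interval Cof) [J.IsTiny] :
    Nonempty (PathTypes J) ∧
    ∀ P : PathTypes J,
      Nonempty P.Formation ∧
      ∃ N : P.Introduction,
        Nonempty (N.Elimination (fun _ => True)) ∧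
        ∃ L : N.Elimination (fun A => Cof.cof (N.map (A ≫ fibTy J))), L.Computation := by
  refine ⟨exists_pathTypes J, fun P => ⟨P.exists_formation, ?_⟩⟩
  obtain ⟨N⟩ := P.exists_introduction
  exact ⟨N, ⟨N.botLocus.elimination⟩, N.conLocus.elimination, N.computation_conLocus⟩
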